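/- Let $k$ be an algebraically closed field of characteristic $p>0$, let $G\subseteq GL_n$ be a connected reductive linear algebraic group over $k$ with Lie algebra $\mathfrak g$, and let $T\subseteq G$ be a maximal torus with Lie algebra $\mathfrak t=X_*(T)\otimes k$ and $\mathfrak t_{\mathbb F_p}=X_*(T)\otimes\mathbb F_p\subseteq\mathfrak t$. Fix an $\mathbb F_p$-linear retraction $r:k\to\mathbb F_p$ of the inclusion $\mathbb F_p\subseteq k$, and let $\pi=\mathrm{id}\otimes r:\mathfrak t\to\mathfrak t_{\mathbb F_p}$ be the induced splitting. For $a\in\mathfrak g$ with semisimple part $s$, we say that $\tau'$ is the rational part of $a$ if $\mathrm{Ad}(g)s\in\mathfrak t$ and $\mathrm{Ad}(g)\tau'=\pi(\mathrm{Ad}(g)s)$ for some $g\in G(k)$. Let $\tau\in\mathfrak g$ be rational semisimple, i.e. conjugate under $G(k)$ to an element of $\mathfrak t_{\mathbb F_p}$. Put $\mathcal O=k[[z]]$. Let $\mathrm{Locsys}^{tame}_{G,\tau}(\mathbb D)$ be the category whose objects are the tame connections $d+A\frac{dz}{z}$, $A=\sum_{i\ge0}a_iz^i\in\mathfrak g(\mathcal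 O)$, such that the rational part of the residue $a_0$ is conjugate under $G(k)$ to $\tau$, and whose morphisms $A\to B$ are the $g\in G(\mathcal O)$ with $dg\,g^{-1}+\mathrm{Ad}(g)A\frac{dz}{z}=B\frac{dz}{z}$. Let $G'_\tau(\mathcal O)\subseteq G(\mathcal O)$ be the group of automorphisms of the connection $d+\tau\frac{dz}{z}$, and let $\mathfrak g'_\tau(\mathcal O)=\{\sum_{i\ge0} a_iz^i\in\mathfrak g(\mathcal O): [\tau,a_i]=i\,a_i\text{ for all }i\}$ be its Lie algebra, a module over the coordinate ring $\mathcal O'=k[[w]]$, $w=z^p$, of the Frobenius twist $\mathbb D'$. Let $\mathrm{Higgs}^{tame}_{G'_\tau,irr}(\mathbb D')$ be the category whose objects are the tame Higgs fields $\varphi\frac{dw}{w}$ on $\mathbb D'$, $\varphi=\sum_{i\ge0}\varphi_iz^i\in\mathfrak g'_\tau(\mathcal O)$, whose residue $\varphi_0\in\mathrm{Lie}\,Z_G(\tau)$ has irrational semisimple part $s$ (that is, for some $g\in G(k)$ with $\mathrm{Ad}(g)\tau\in\mathfrak t_{\mathbb F_p}$, so that $g^{-1}Tg$ is a maximal torus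 of $Z_G(\tau)$, one has $\mathrm{Ad}(g)s\in\mathfrak t$ and $\pi(\mathrm{Ad}(g)s)=0$), and whose morphisms $\varphi\to\psi$ are the $g\in G'_\tau(\mathcal O)$ with $\mathrm{Ad}(g)\varphi=\psi$. A connection $A$ is in standard form if each $a_i$ lies in the generalized eigenspace of $[a_0,-]$ with eigenvalue $i$. Then: 1. Every object of $\mathrm{Locsys}^{tame}_{G,\tau}(\mathbb D)$ is gauge equivalent under $G(\mathcal O)$ to one in standard form such that the rational part of its residue is $\tau$ itself. 2. There is a bijection from the $G(\mathcal O)$-gauge equivalence classes in $\mathrm{Locsys}^{tame}_{G,\tau}(\mathbb D)$ to the $G'_\tau(\mathcal O)$-adjoint equivalence classes in $\mathrm{Higgs}^{tame}_{G'_\tau,irr}(\mathbb D')$ which sends the class of $A$ to the class of $A-\tau$ whenever $A$ is as in 1; in particular $A-\tau$ is then such a Higgs field. 3. The assignment $\varphi\mapsto\varphi+\tau$ on objects, $g\mapsto g$ on morphisms, is an equivalence of categories $\mathrm{Higgs}^{tame}_{G'_\tau,irr}(\mathbb D')\to\mathrm{Locsys}^{tame}_{G,\tau}(\mathbb D)$.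 -/

import Mathlib

open CategoryTheory
open scoped MatrixGroups PowerSeries

/-! ### Linear algebraic groups over an algebraically closed field -/

section AlgebraicGroups

set_option linter.unusedSectionVars false

variable {k : Type*} [Field k] {n : Type*} [Fintype n] [DecidableEq n]

/-- The value of a polynomial in the matrix entries at a matrix over a `k`-algebra. -/
noncomputable def evalMat {R : Type*} [CommRing R] [Algebra k R]
    (f : MvPolynomial (n × n) k) (M : Matrix n n R) : R :=
  MvPolynomial.aeval (fun ij : n × n => M ij.1 ij.2) f

/-- The polynomials in the matrix entries vanishing on a set of invertible matrices. -/
def vanishing (S : Set (GL n k)) : Set (MvPolynomial (n × n) k) :=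
  {f | ∀ g ∈ S, evalMat f (g : Matrix n n k) = 0}

/-- The locus in `GL_n(k)` where all polynomials of a given set vanish. -/
def zeroLocus (P : Set (MvPolynomial (n × n) k)) : Set (GL n k) :=
  {g | ∀ f ∈ P, evalMat f (g : Matrix n n k) = 0}

/-- The Zariski topology on `GL_n(k)`: the closed sets are the zero loci. -/
@[reducible] def zariski (n k : Type*) [Field k] [Fintype n] [DecidableEq n] : TopologicalSpace (GL n k) :=
  TopologicalSpace.ofClosed {Z | ∃ P : Set (MvPolynomial (n × n) k), Z = zeroLocus P}
    ⟨{1}, by ext g; simp [zeroLocus, evalMat]⟩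
    (by
      intro A hA
      choose P hP using hA
      refine ⟨{f | ∃ (Z : _) (hZ : Z ∈ A), f ∈ P hZ}, ?_⟩
      ext g
      constructor
      · rintro h f ⟨Z, hZ, hf⟩
        have := h Z hZ
        rw [hP hZ] at this
        exact this f hf
      · intro h Z hZ
        rw [hP hZ]
        exact fun f hf => h f ⟨Z, hZ, hf⟩)
    (by
      rintro _ ⟨P, rfl⟩ _ ⟨Q, rfl⟩
      refine ⟨{f | ∃ a ∈ P, ∃ b ∈ Q, f = a * b}, ?_⟩
      ext g
      simp only [Set.mem_union, zeroLocus, Set.mem_ofPred_eq]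
      constructor
      · rintro (h | h) _ ⟨a, ha, b, hb, rfl⟩
        · simp [evalMat, map_mul] at h ⊢
          exact Or.inl (h a ha)
        · simp [evalMat, map_mul] at h ⊢
          exact Or.inr (h b hb)
      · intro h
        by_contra! hc
        obtain ⟨⟨a, ha, ha'⟩, b, hb, hb'⟩ := hc
        have := h (a * b) ⟨a, ha, b, hb, rfl⟩
        simp only [evalMat, map_mul, mul_eq_zero] at this ha' hb'
        tauto)

/-- `H` is a Zariski closed subgroup of `GL_n(k)`, i.e. a linear algebraic group. -/
def IsZariskiClosed (H : Subgroup (GL n k)) : Prop :=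
  @IsClosed (GL n k) (zariski n k) (H : Set (GL n k))

/-- `H` is connected in the Zariski topology. -/
def IsZariskiConnected (H : Subgroup (GL n k)) : Prop :=
  @IsConnected (GL n k) (zariski n k) (H : Set (GL n k))

/-- `G` is a connected reductive linear algebraic group: closed, connected, and every closed
connected normal unipotent subgroup of `G` is trivial. -/
structure IsConnectedReductive (G : Subgroup (GL n k)) : Prop where
  closed : IsZariskiClosed G
  connected : IsZariskiConnected G
  unipotentRadical_trivial : ∀ U : Subgroup (GL n k), U ≤ G → IsZariskiClosed U →
    IsZariskiConnected U → (∀ g ∈ G, ∀ u ∈ U, g * u * g⁻¹ ∈ U) →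
    (∀ u ∈ U, IsNilpotent ((u : Matrix n n k) - 1)) → U = ⊥

/-- `T` is a torus: closed, connected, and simultaneously diagonalizable. -/
structure IsTorus (T : Subgroup (GL n k)) : Prop where
  closed : IsZariskiClosed T
  connected : IsZariskiConnected T
  diagonalizable : ∃ P : GL n k, ∀ t ∈ T, ((P * t * P⁻¹ : GL n k) : Matrix n n k).IsDiag

/-- `T` is a maximal torus of `G`. -/
structure IsMaximalTorus (G T : Subgroup (GL n k)) : Prop where
  le : T ≤ G
  torus : IsTorus T
  maximal : ∀ S : Subgroup (GL n k), S ≤ G → IsTorus S → T ≤ S → S = T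

/-- The Lie algebra of `G`: the Zariski tangent space at the identity, as a space of matrices. -/
noncomputable def lieAlg (G : Subgroup (GL n k)) : Submodule k (Matrix n n k) where
  carrier := {X | ∀ f ∈ vanishing (G : Set (GL n k)),
    ∑ ij : n × n, evalMat (MvPolynomial.pderiv ij f) (1 : Matrix n n k) * X ij.1 ij.2 = 0}
  zero_mem' := by simp
  add_mem' := by
    intro X Y hX hY f hf
    simp only [Matrix.add_apply, mul_add, Finset.sum_add_distrib, hX f hf, hY f hf, add_zero]
  smul_mem' := by
    intro c X hX f hf
    have h := hX f hf
    simp only [Matrix.smul_apply, smul_eq_mul, mul_left_comm _ c, ← Finset.mul_sum, h, mul_zero]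

section Points

variable {R : Type*} [CommRing R] [Algebra k R]

/-- A polynomial over `R` which vanishes at all points of `S` over `k` vanishes at all `R`-points of
the closure of `S`. -/
theorem eval_eq_zero_of_vanishing (S : Set (GL n k)) (F : MvPolynomial (n × n) R)
    (hF : ∀ h ∈ S, MvPolynomial.eval
      (fun ij : n × n => algebraMap k R ((h : Matrix n n k) ij.1 ij.2)) F = 0)
    (x : Matrix n n R) (hx : ∀ f ∈ vanishing S, evalMat f x = 0) :
    MvPolynomial.eval (fun ij : n × n => x ij.1 ij.2) F = 0 := by
  classical
  let b := Module.Basis.ofVectorSpace k R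
  let q : Module.Basis.ofVectorSpaceIndex k R → MvPolynomial (n × n) k := fun j =>
    ∑ m ∈ F.support, MvPolynomial.monomial m (b.repr (F.coeff m) j)
  have hq : ∀ j, q j ∈ vanishing S := by
    intro j h hh
    have h0 := hF h hh
    rw [MvPolynomial.eval_eq] at h0
    have h1 := congrArg (fun y => b.repr y j) h0
    simp only [evalMat, q, map_sum, MvPolynomial.aeval_monomial]
    simp only [map_sum, map_zero, Finsupp.coe_zero, Pi.zero_apply, Finsupp.finsetSum_apply] at h1
    rw [← h1]
    refine Finset.sum_congr rfl fun m _ => ?_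
    have : F.coeff m * ∏ i ∈ m.support, algebraMap k R ((h : Matrix n n k) i.1 i.2) ^ m i
        = (∏ i ∈ m.support, ((h : Matrix n n k) i.1 i.2) ^ m i) • F.coeff m := by
      rw [Algebra.smul_def, map_prod, mul_comm]; simp
    rw [this, map_smul]
    simp [Finsupp.prod, mul_comm]
  have hx' : ∀ j, ∑ m ∈ F.support,
      (b.repr (F.coeff m) j) • ∏ i ∈ m.support, (x i.1 i.2) ^ m i = 0 := by
    intro j
    have := hx (q j) (hq j)
    simpa [evalMat, q, map_sum, MvPolynomial.aeval_monomial, Finsupp.prod, Algebra.smul_def]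
      using this
  rw [MvPolynomial.eval_eq]
  have hc : ∀ m, F.coeff m = ∑ j ∈ F.support.biUnion (fun m => (b.repr (F.coeff m)).support),
      (if m ∈ F.support then b.repr (F.coeff m) j else 0) • b j := by
    intro m
    by_cases hm : m ∈ F.support
    · simp only [hm, if_true]
      conv_lhs => rw [← b.linearCombination_repr (F.coeff m), Finsupp.linearCombination_apply]
      rw [Finsupp.sum]
      refine Finset.sum_subset ?_ ?_
      · intro j hj
        exact Finset.mem_biUnion.2 ⟨m, hm, hj⟩
      · intro j _ hj
        simp [Finsupp.notMem_support_iff.1 hj]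
    · simpa only [hm, if_false, zero_smul, Finset.sum_const_zero] using
        MvPolynomial.notMem_support_iff.1 hm
  have hstep : ∀ m ∈ F.support, F.coeff m * ∏ i ∈ m.support, (x i.1 i.2) ^ m i =
      ∑ j ∈ F.support.biUnion (fun m => (b.repr (F.coeff m)).support),
        b j * ((b.repr (F.coeff m) j) • ∏ i ∈ m.support, (x i.1 i.2) ^ m i) := by
    intro m hm
    conv_lhs => rw [hc m]
    rw [Finset.sum_mul]
    refine Finset.sum_congr rfl fun j _ => ?_
    rw [if_pos hm, smul_mul_assoc, mul_smul_comm]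
  rw [Finset.sum_congr rfl hstep, Finset.sum_comm]
  refine Finset.sum_eq_zero fun j _ => ?_
  rw [← Finset.mul_sum, hx' j, mul_zero]

/-- Composing a polynomial in the entries with left multiplication by a matrix over `R`. -/
theorem exists_eval_mul (f : MvPolynomial (n × n) k) (A : Matrix n n R) :
    ∃ F : MvPolynomial (n × n) R, ∀ y : Matrix n n R,
      MvPolynomial.eval (fun ij : n × n => y ij.1 ij.2) F = evalMat f (A * y) := by
  refine ⟨MvPolynomial.aeval (fun ij : n × n =>
    (A.map MvPolynomial.C * Matrix.mvPolynomialX n n R :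
      Matrix n n (MvPolynomial (n × n) R)) ij.1 ij.2) f, fun y => ?_⟩
  induction f using MvPolynomial.induction_on with
  | C a =>
    simp [evalMat, MvPolynomial.algebraMap_eq, IsScalarTower.algebraMap_apply k R
      (MvPolynomial (n × n) R)]
  | add p q hp hq => simpa [evalMat] using congrArg₂ (· + ·) hp hq
  | mul_X p i hp =>
    simp only [evalMat, map_mul, MvPolynomial.aeval_X] at hp ⊢
    rw [hp]
    simp [Matrix.mul_apply]

/-- Composing a polynomial in the entries with right multiplication by a matrix over `k`. -/
noncomputable def rightTranslate (f : MvPolynomial (n × n) k) (B : Matrix n n k) :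
    MvPolynomial (n × n) k :=
  MvPolynomial.aeval (fun ij : n × n =>
    (Matrix.mvPolynomialX n n k * B.map MvPolynomial.C :
      Matrix n n (MvPolynomial (n × n) k)) ij.1 ij.2) f

theorem evalMat_rightTranslate (f : MvPolynomial (n × n) k) (B : Matrix n n k)
    (y : Matrix n n R) :
    evalMat (rightTranslate f B) y = evalMat f (y * B.map (algebraMap k R)) := by
  unfold rightTranslate
  induction f using MvPolynomial.induction_on with
  | C a => simp [evalMat, MvPolynomial.algebraMap_eq]
  | add p q hp hq => simpa [evalMat] using congrArg₂ (· + ·) hp hq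
  | mul_X p i hp =>
    simp only [evalMat, map_mul, MvPolynomial.aeval_X] at hp ⊢
    rw [hp]
    simp [Matrix.mul_apply]

theorem evalMat_mul (a b : MvPolynomial (n × n) k) (x : Matrix n n R) :
    evalMat (a * b) x = evalMat a x * evalMat b x := by
  simp [evalMat]

theorem mapMatrix_mvPolynomialX (x : Matrix n n R) :
    (MvPolynomial.aeval (R := k) (fun ij : n × n => x ij.1 ij.2)).mapMatrix
      (Matrix.mvPolynomialX n n k) = x := by
  ext a b; simp

theorem evalMat_map_algebraMap (f : MvPolynomial (n × n) k) (x : Matrix n n k) :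
    evalMat f (x.map (algebraMap k R)) = algebraMap k R (evalMat f x) := by
  simp only [evalMat]
  rw [← MvPolynomial.aeval_algebraMap_apply]
  rfl

theorem evalMat_det (x : Matrix n n R) :
    evalMat (Matrix.mvPolynomialX n n k).det x = x.det := by
  have h := AlgHom.map_det (MvPolynomial.aeval (R := k) (fun ij : n × n => x ij.1 ij.2))
    (Matrix.mvPolynomialX n n k)
  rwa [mapMatrix_mvPolynomialX] at h

theorem evalMat_adjugate (x : Matrix n n R) (i j : n) :
    evalMat ((Matrix.mvPolynomialX n n k).adjugate i j) x = x.adjugate i j := by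
  have h := AlgHom.map_adjugate (MvPolynomial.aeval (R := k) (fun ij : n × n => x ij.1 ij.2))
    (Matrix.mvPolynomialX n n k)
  rw [mapMatrix_mvPolynomialX] at h
  exact congrFun (congrFun h i) j

theorem adjugate_eq_det_mul_inv (x : GL n R) (i j : n) :
    (x : Matrix n n R).adjugate i j =
      (x : Matrix n n R).det * ((x⁻¹ : GL n R) : Matrix n n R) i j := by
  have h : (x : Matrix n n R).adjugate
      = (x : Matrix n n R).det • ((x⁻¹ : GL n R) : Matrix n n R) := by
    have h1 := Matrix.adjugate_mul (x : Matrix n n R)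
    have h2 := congrArg (· * ((x⁻¹ : GL n R) : Matrix n n R)) h1
    have h3 : (x : Matrix n n R) * ((x⁻¹ : GL n R) : Matrix n n R) = 1 := x.mul_inv
    simp only [mul_assoc, h3, mul_one, smul_mul_assoc, one_mul] at h2
    exact h2
  rw [h, Matrix.smul_apply, smul_eq_mul]

/-- Composing a polynomial in the entries with inversion, up to a power of the determinant. -/
theorem exists_evalMat_inv (f : MvPolynomial (n × n) k) :
    ∃ (f' : MvPolynomial (n × n) k) (N : ℕ),
      (∀ x : GL n k, evalMat f' (x : Matrix n n k) =
        (x : Matrix n n k).det ^ N * evalMat f ((x⁻¹ : GL n k) : Matrix n n k)) ∧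
      (∀ x : GL n R, evalMat f' (x : Matrix n n R) =
        (x : Matrix n n R).det ^ N * evalMat f ((x⁻¹ : GL n R) : Matrix n n R)) := by
  induction f using MvPolynomial.induction_on with
  | C a => exact ⟨MvPolynomial.C a, 0, by simp [evalMat], by simp [evalMat]⟩
  | add f g hf hg =>
    obtain ⟨f', N, h1, h2⟩ := hf
    obtain ⟨g', M, h3, h4⟩ := hg
    refine ⟨(Matrix.mvPolynomialX n n k).det ^ M * f' + (Matrix.mvPolynomialX n n k).det ^ N * g',
      N + M, fun x => ?_, fun x => ?_⟩
    · have hd := evalMat_det (k := k) (x : Matrix n n k)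
      have e1 := h1 x
      have e2 := h3 x
      simp only [evalMat, map_add, map_mul, map_pow] at hd e1 e2 ⊢
      rw [hd, e1, e2]; ring
    · have hd := evalMat_det (k := k) (x : Matrix n n R)
      have e1 := h2 x
      have e2 := h4 x
      simp only [evalMat, map_add, map_mul, map_pow] at hd e1 e2 ⊢
      rw [hd, e1, e2]; ring
  | mul_X f ij hf =>
    obtain ⟨f', N, h1, h2⟩ := hf
    refine ⟨f' * (Matrix.mvPolynomialX n n k).adjugate ij.1 ij.2, N + 1, fun x => ?_, fun x => ?_⟩
    · rw [evalMat_mul, evalMat_mul, h1, evalMat_adjugate, adjugate_eq_det_mul_inv]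
      simp only [evalMat, MvPolynomial.aeval_X]; ring
    · rw [evalMat_mul, evalMat_mul, h2, evalMat_adjugate, adjugate_eq_det_mul_inv]
      simp only [evalMat, MvPolynomial.aeval_X]; ring

variable (R) in
/-- The group `G(R)` of points of `G` over a `k`-algebra `R`: the invertible matrices over `R`
annihilated by all polynomials over `k` that vanish on `G`. -/
def points (G : Subgroup (GL n k)) : Subgroup (GL n R) where
  carrier := {x | ∀ f ∈ vanishing (G : Set (GL n k)), evalMat f (x : Matrix n n R) = 0}
  one_mem' := by
    intro f hf
    have h := hf 1 G.one_mem
    have hmap : evalMat f (1 : Matrix n n R) = algebraMap k R (evalMat f (1 : Matrix n n k)) := by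
      have h1 := evalMat_map_algebraMap (R := R) f (1 : Matrix n n k)
      rwa [Matrix.map_one _ (map_zero _) (map_one _)] at h1
    have h' : evalMat f (1 : Matrix n n k) = 0 := by simpa using h
    rw [Units.val_one, hmap, h', map_zero]
  mul_mem' := by
    intro x y hx hy f hf
    have hk : ∀ h ∈ (G : Set (GL n k)), evalMat f ((x : Matrix n n R) *
        ((h : Matrix n n k).map (algebraMap k R))) = 0 := by
      intro h hh
      rw [← evalMat_rightTranslate]
      refine hx _ fun g hg => ?_
      have h1 := evalMat_rightTranslate f (h : Matrix n n k) (g : Matrix n n k)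
      have h2 := hf (g * h) (G.mul_mem hg hh)
      rw [h1]
      simpa using h2
    obtain ⟨F, hF⟩ := exists_eval_mul f (x : Matrix n n R)
    have := eval_eq_zero_of_vanishing (G : Set (GL n k)) F
      (fun h hh => by
        have h1 := hF ((h : Matrix n n k).map (algebraMap k R))
        rw [hk h hh] at h1
        exact h1) (y : Matrix n n R) hy
    rw [hF] at this
    rwa [Units.val_mul]
  inv_mem' := by
    intro x hx f hf
    obtain ⟨f', N, h1, h2⟩ := exists_evalMat_inv (R := R) f
    have hf' : f' ∈ vanishing (G : Set (GL n k)) := by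
      intro g hg
      rw [h1, hf _ (G.inv_mem hg), mul_zero]
    have h3 := hx f' hf'
    rw [h2] at h3
    have hu : IsUnit ((x : Matrix n n R).det ^ N) :=
      ((Matrix.isUnit_iff_isUnit_det _).1 x.isUnit).pow N
    exact (hu.mul_right_eq_zero).1 h3

end Points

end AlgebraicGroups

/-! ### Rational and irrational parts of semisimple elements -/

section RationalParts

variable {k : Type*} [Field k] {n : Type*} [Fintype n] [DecidableEq n]

/-- A cocharacter `𝔾_m → T`: a homomorphism `kˣ → T` of the form `t ↦ ∑ m, t ^ m • coeff m`, i.e.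
one whose matrix entries are Laurent polynomials in `t`. -/
structure Cocharacter (T : Subgroup (GL n k)) where
  hom : kˣ →* GL n k
  mem : ∀ t, hom t ∈ T
  coeff : ℤ →₀ Matrix n n k
  hom_eq : ∀ t, (hom t : Matrix n n k) = coeff.sum fun m C => ((t ^ m : kˣ) : k) • C

/-- The differential `dϑ(1)` of a cocharacter `ϑ`, i.e. the derivative at `t = 1` of
`t ↦ ∑ m, t ^ m • coeff m`; it is the element `ϑ ⊗ 1` of `X_*(T) ⊗ k = 𝔱`. -/
noncomputable def Cocharacter.differential {T : Subgroup (GL n k)} (ϑ : Cocharacter T) :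
    Matrix n n k :=
  ϑ.coeff.sum fun m C => (m : k) • C

/-- `𝔱_{𝔽_p} = X_*(T) ⊗ 𝔽_p`: the additive subgroup of `𝔱` generated by the differentials of the
cocharacters of `T`. -/
def rationalPoints (T : Subgroup (GL n k)) : AddSubgroup (Matrix n n k) :=
  AddSubgroup.closure (Set.range (Cocharacter.differential (T := T)))

/-- `τ ∈ 𝔤` is rational semisimple: it is conjugate under `G` to an element of `𝔱_{𝔽_p}`. -/
def IsRationalSemisimple (G T : Subgroup (GL n k)) (τ : Matrix n n k) : Prop :=
  ∃ g ∈ G, (g : Matrix n n k) * τ * ((g⁻¹ : GL n k) : Matrix n n k) ∈ rationalPoints T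

/-- `a = s + ν` is the Jordan decomposition of `a`, with semisimple part `s`. -/
structure IsJordanDecomposition (a s ν : Matrix n n k) : Prop where
  add_eq : a = s + ν
  commute : Commute s ν
  semisimple : Module.End.IsSemisimple (Matrix.toLin' s)
  nilpotent : IsNilpotent ν

variable {p : ℕ} [Fact p.Prime] [Algebra (ZMod p) k]

/-- `s ∈ 𝔱` and `π(s) = τ`, where `π : 𝔱 = X_*(T) ⊗ k → X_*(T) ⊗ 𝔽_p = 𝔱_{𝔽_p}` is the splitting
`id ⊗ r` of `𝔱_{𝔽_p} ↪ 𝔱` induced by an `𝔽_p`-linear retraction `r : k → 𝔽_p`: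
`π(∑ c_i dϑ_i(1)) = ∑ r(c_i) dϑ_i(1)`. -/
def SplittingMapsTo (r : k →ₗ[ZMod p] ZMod p) (T : Subgroup (GL n k)) (s τ : Matrix n n k) :
    Prop :=
  ∃ (m : ℕ) (ϑ : Fin m → Cocharacter T) (c : Fin m → k),
    s = ∑ i, c i • (ϑ i).differential ∧
    τ = ∑ i, algebraMap (ZMod p) k (r (c i)) • (ϑ i).differential

/-- `τ` is the rational part (of the semisimple part `s`) of `a ∈ 𝔤`: some `g ∈ G` moves `s` into
`𝔱` and `τ` to the rational part `π(Ad(g) s)`. -/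
def HasRationalPart (r : k →ₗ[ZMod p] ZMod p) (G T : Subgroup (GL n k)) (a τ : Matrix n n k) :
    Prop :=
  ∃ s ν : Matrix n n k, IsJordanDecomposition a s ν ∧ ∃ g ∈ G,
    SplittingMapsTo r T ((g : Matrix n n k) * s * ((g⁻¹ : GL n k) : Matrix n n k))
      ((g : Matrix n n k) * τ * ((g⁻¹ : GL n k) : Matrix n n k))

/-- The semisimple part `s` of `a`, an element of the Lie algebra of the centralizer `Z_G(τ)` of a
rational semisimple `τ`, is irrational: for some maximal torus `g⁻¹ T g` of `Z_G(τ)` (so that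
`Ad(g) τ ∈ 𝔱`), `s` lies in its Lie algebra and has rational part zero there. -/
def HasIrrationalSemisimplePart (r : k →ₗ[ZMod p] ZMod p) (G T : Subgroup (GL n k))
    (τ a : Matrix n n k) : Prop :=
  ∃ s ν : Matrix n n k, IsJordanDecomposition a s ν ∧ ∃ g ∈ G,
    (g : Matrix n n k) * τ * ((g⁻¹ : GL n k) : Matrix n n k) ∈ rationalPoints T ∧
    SplittingMapsTo r T ((g : Matrix n n k) * s * ((g⁻¹ : GL n k) : Matrix n n k)) 0

end RationalParts

/-! ### Tame connections on the formal disc -/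

section FormalDisc

set_option linter.unusedSectionVars false

variable {k : Type*} [Field k] {n : Type*} [Fintype n] [DecidableEq n]

/-- The coefficient `a_i` of `A = ∑ a_i z ^ i`. -/
noncomputable def coeffMat (i : ℕ) (A : Matrix n n k⟦X⟧) : Matrix n n k :=
  A.map (PowerSeries.coeff i)

/-- A matrix over `k` as a constant matrix over `𝒪 = k⟦z⟧`. -/
noncomputable def constMat (a : Matrix n n k) : Matrix n n k⟦X⟧ :=
  a.map (PowerSeries.C)

/-- The derivation `z d/dz` on matrices over `𝒪`, so that `dg = eulerMat g · dz/z`. -/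
noncomputable def eulerMat (A : Matrix n n k⟦X⟧) : Matrix n n k⟦X⟧ :=
  A.map fun f => PowerSeries.X * PowerSeries.derivative k f

/-- `𝔤(𝒪)`: the power series with coefficients in `𝔤`. The element `A` stands for the tame
`G`-connection `d + A dz/z`. -/
def loopAlg (G : Subgroup (GL n k)) : Set (Matrix n n k⟦X⟧) :=
  {A | ∀ i, coeffMat i A ∈ lieAlg G}

/-- The adjoint action of `g` on `A`. -/
noncomputable def adj (g : GL n k⟦X⟧) (A : Matrix n n k⟦X⟧) : Matrix n n k⟦X⟧ :=
  (g : Matrix n n k⟦X⟧) * A * ((g⁻¹ : GL n k⟦X⟧) : Matrix n n k⟦X⟧)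

/-- The gauge action: `gaugeAct g A · dz/z = dg g⁻¹ + Ad(g) A · dz/z`. -/
noncomputable def gaugeAct (g : GL n k⟦X⟧) (A : Matrix n n k⟦X⟧) : Matrix n n k⟦X⟧ :=
  eulerMat (g : Matrix n n k⟦X⟧) * ((g⁻¹ : GL n k⟦X⟧) : Matrix n n k⟦X⟧) + adj g A

theorem adj_one (A : Matrix n n k⟦X⟧) : adj 1 A = A := by simp [adj]

theorem adj_mul (g h : GL n k⟦X⟧) (A : Matrix n n k⟦X⟧) : adj (g * h) A = adj g (adj h A) := by
  simp [adj, mul_assoc]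

theorem eulerMat_mul (A B : Matrix n n k⟦X⟧) :
    eulerMat (A * B) = eulerMat A * B + A * eulerMat B := by
  ext1 i j
  simp only [eulerMat, Matrix.map_apply, Matrix.mul_apply, Matrix.add_apply, map_sum,
    Derivation.leibniz, smul_eq_mul, Finset.mul_sum, ← Finset.sum_add_distrib]
  exact Finset.sum_congr rfl fun l _ => by ring

theorem eulerMat_one : eulerMat (1 : Matrix n n k⟦X⟧) = 0 := by
  ext1 i j
  simp only [eulerMat, Matrix.map_apply, Matrix.one_apply, Matrix.zero_apply]
  split_ifs <;> simp

theorem gaugeAct_one (A : Matrix n n k⟦X⟧) : gaugeAct 1 A = A := by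
  simp [gaugeAct, adj_one, eulerMat_one]

theorem gaugeAct_mul (g h : GL n k⟦X⟧) (A : Matrix n n k⟦X⟧) :
    gaugeAct (g * h) A = gaugeAct g (gaugeAct h A) := by
  have hh : (h : Matrix n n k⟦X⟧) * ((h⁻¹ : GL n k⟦X⟧) : Matrix n n k⟦X⟧) = 1 := h.mul_inv
  simp only [gaugeAct, adj_mul, Units.val_mul, eulerMat_mul, mul_inv_rev]
  have h1 : eulerMat (g : Matrix n n k⟦X⟧) * (h : Matrix n n k⟦X⟧) *
      (((h⁻¹ : GL n k⟦X⟧) : Matrix n n k⟦X⟧) * ((g⁻¹ : GL n k⟦X⟧) : Matrix n n k⟦X⟧)) =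
      eulerMat (g : Matrix n n k⟦X⟧) * ((g⁻¹ : GL n k⟦X⟧) : Matrix n n k⟦X⟧) := by
    rw [mul_assoc, ← mul_assoc (h : Matrix n n k⟦X⟧), hh, one_mul]
  rw [add_mul, h1, add_assoc]
  congr 1
  simp only [adj, mul_add, add_mul, mul_assoc]

/-- The operator `[a, -]` on matrices. -/
def adLie (a : Matrix n n k) : Module.End k (Matrix n n k) :=
  LinearMap.mulLeft k a - LinearMap.mulRight k a

/-- `A = ∑ a_i z ^ i` is in standard form: `a_i` lies in the generalized eigenspace of `[a_0, -]`
with eigenvalue `i`. -/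
def IsStandardForm (A : Matrix n n k⟦X⟧) : Prop :=
  ∀ i : ℕ, coeffMat i A ∈
    Module.End.maxGenEigenspace (adLie (coeffMat 0 A)) (i : k)

/-- `G'_τ(𝒪)`: the automorphisms in `G(𝒪)` of the `G`-connection `d + τ dz/z`. -/
def gaugeStabilizer (G : Subgroup (GL n k)) (τ : Matrix n n k) : Subgroup (GL n k⟦X⟧) where
  carrier := {g | g ∈ points k⟦X⟧ G ∧ gaugeAct g (constMat τ) = constMat τ}
  one_mem' := ⟨one_mem _, gaugeAct_one _⟩
  mul_mem' := by
    rintro g h ⟨hg, hg'⟩ ⟨hh, hh'⟩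
    exact ⟨mul_mem hg hh, by rw [gaugeAct_mul, hh', hg']⟩
  inv_mem' := by
    rintro g ⟨hg, hg'⟩
    refine ⟨inv_mem hg, ?_⟩
    conv_lhs => rw [← hg']
    rw [← gaugeAct_mul, inv_mul_cancel, gaugeAct_one]

/-- The coordinate ring `𝒪' = k⟦w⟧`, `w = z ^ p`, of the Frobenius twist `𝔻'` of the formal disc,
as the subalgebra of `𝒪 = k⟦z⟧` of power series in `z ^ p`. -/
def frobeniusTwist (p : ℕ) (k : Type*) [Field k] : Subalgebra k k⟦X⟧ where
  carrier := {f | ∀ i, ¬ p ∣ i → PowerSeries.coeff i f = 0}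
  mul_mem' := by
    intro f g hf hg i hi
    rw [PowerSeries.coeff_mul]
    refine Finset.sum_eq_zero fun ab hab => ?_
    by_cases ha : p ∣ ab.1
    · rw [hg ab.2 fun hb => hi (Finset.HasAntidiagonal.mem_antidiagonal.1 hab ▸ dvd_add ha hb), mul_zero]
    · rw [hf ab.1 ha, zero_mul]
  add_mem' := by
    intro f g hf hg i hi
    rw [map_add, hf i hi, hg i hi, add_zero]
  algebraMap_mem' := by
    intro c i hi
    rw [PowerSeries.algebraMap_apply, Algebra.algebraMap_self, RingHom.id_apply,
      PowerSeries.coeff_C, if_neg]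
    rintro rfl
    exact hi (dvd_zero p)

/-- `𝔤'_τ(𝒪)`, the Lie algebra of `G'_τ(𝒪)`: the series `∑ a_i z ^ i` with `a_i ∈ 𝔤` in the
eigenspace of `[τ, -]` with eigenvalue `i`. It is a module over the coordinate ring `𝒪'` of the
Frobenius twist `𝔻'`. The element `φ` stands for the tame `G'_τ(𝒪)`-Higgs field `φ dw/w`
on `𝔻'`. -/
def gaugeStabilizerAlg (p : ℕ) [CharP k p] (G : Subgroup (GL n k)) (τ : Matrix n n k) :
    Submodule (frobeniusTwist p k) (Matrix n n k⟦X⟧) where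
  carrier := {A | ∀ i : ℕ, coeffMat i A ∈ lieAlg G ∧ adLie τ (coeffMat i A) = (i : k) • coeffMat i A}
  zero_mem' := by
    intro i
    have h : coeffMat i (0 : Matrix n n k⟦X⟧) = 0 := by ext; simp [coeffMat]
    rw [h]
    exact ⟨zero_mem _, by simp⟩
  add_mem' := by
    intro A B hA hB i
    have h : coeffMat i (A + B) = coeffMat i A + coeffMat i B := by ext; simp [coeffMat]
    rw [h]
    exact ⟨add_mem (hA i).1 (hB i).1, by rw [map_add, (hA i).2, (hB i).2, smul_add]⟩
  smul_mem' := by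
    rintro ⟨f, hf⟩ A hA i
    have h : coeffMat i ((⟨f, hf⟩ : frobeniusTwist p k) • A) =
        ∑ ab ∈ Finset.HasAntidiagonal.antidiagonal i, PowerSeries.coeff ab.1 f • coeffMat ab.2 A := by
      ext a b
      have : ((⟨f, hf⟩ : frobeniusTwist p k) • A) a b = f * A a b := rfl
      simp [coeffMat, this, PowerSeries.coeff_mul, Matrix.sum_apply]
    rw [h]
    refine ⟨sum_mem fun ab _ => Submodule.smul_mem _ _ (hA ab.2).1, ?_⟩
    rw [map_sum, Finset.smul_sum]
    refine Finset.sum_congr rfl fun ab hab => ?_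
    by_cases ha : p ∣ ab.1
    · have hc : (i : k) = (ab.2 : k) := by
        rw [← Finset.HasAntidiagonal.mem_antidiagonal.1 hab, Nat.cast_add, (CharP.cast_eq_zero_iff k p ab.1).2 ha,
          zero_add]
      rw [map_smul, (hA ab.2).2, hc, smul_comm]
    · rw [hf ab.1 ha]; simp

end FormalDisc

/-! ### The two categories -/

section Categories

variable {k : Type*} [Field k] {n : Type*} [Fintype n] [DecidableEq n]
  {p : ℕ} [Fact p.Prime] [Algebra (ZMod p) k] [CharP k p]

/-- Tame `G`-connections `d + A dz/z` on the formal disc for which the rational part of the residue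
`a_0` is conjugate to `τ`. -/
structure Locsys (r : k →ₗ[ZMod p] ZMod p) (G T : Subgroup (GL n k)) (τ : Matrix n n k) where
  form : Matrix n n k⟦X⟧
  mem : form ∈ loopAlg G
  rational : ∃ h ∈ G, HasRationalPart r G T (coeffMat 0 form)
    ((h : Matrix n n k) * τ * ((h⁻¹ : GL n k) : Matrix n n k))

/-- Tame `G'_τ(𝒪)`-Higgs fields `φ dw/w` on `𝔻'` whose residue, an element of the Lie algebra of the
Levi quotient `Z_G(τ)` of `G'_τ(𝒪)`, has irrational semisimple part. -/
structure Higgs (r : k →ₗ[ZMod p] ZMod p) (G T : Subgroup (GL n k)) (τ : Matrix n n k) where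
  form : Matrix n n k⟦X⟧
  mem : form ∈ gaugeStabilizerAlg p G τ
  irrational : HasIrrationalSemisimplePart r G T τ (coeffMat 0 form)

variable {r : k →ₗ[ZMod p] ZMod p} {G T : Subgroup (GL n k)} {τ : Matrix n n k}

/-- Gauge transformations in `G(𝒪)` between tame connections. -/
@[ext] structure Locsys.Hom (A B : Locsys r G T τ) where
  val : GL n k⟦X⟧
  mem : val ∈ points k⟦X⟧ G
  gauge_eq : gaugeAct val A.form = B.form

noncomputable instance : Category (Locsys r G T τ) where
  Hom := Locsys.Hom
  id A := ⟨1, one_mem _, gaugeAct_one _⟩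
  comp f g := ⟨g.val * f.val, mul_mem g.mem f.mem, by rw [gaugeAct_mul, f.gauge_eq, g.gauge_eq]⟩
  id_comp f := Locsys.Hom.ext (mul_one _)
  comp_id f := Locsys.Hom.ext (one_mul _)
  assoc f g h := Locsys.Hom.ext (mul_assoc _ _ _).symm

/-- Elements of `G'_τ(𝒪)` carrying one Higgs field to another under the adjoint action. -/
@[ext] structure Higgs.Hom (φ ψ : Higgs r G T τ) where
  val : GL n k⟦X⟧
  mem : val ∈ gaugeStabilizer G τ
  adj_eq : adj val φ.form = ψ.form

noncomputable instance : Category (Higgs r G T τ) where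
  Hom := Higgs.Hom
  id φ := ⟨1, one_mem _, adj_one _⟩
  comp f g := ⟨g.val * f.val, mul_mem g.mem f.mem, by rw [adj_mul, f.adj_eq, g.adj_eq]⟩
  id_comp f := Higgs.Hom.ext (mul_one _)
  comp_id f := Higgs.Hom.ext (one_mul _)
  assoc f g h := Higgs.Hom.ext (mul_assoc _ _ _).symm

/-- Gauge equivalence of tame connections under `G(𝒪)`. -/
instance Locsys.setoid (r : k →ₗ[ZMod p] ZMod p) (G T : Subgroup (GL n k)) (τ : Matrix n n k) :
    Setoid (Locsys r G T τ) where
  r A B := ∃ g ∈ points k⟦X⟧ G, gaugeAct g A.form = B.form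
  iseqv :=
    { refl := fun A => ⟨1, one_mem _, gaugeAct_one _⟩
      symm := by
        rintro A B ⟨g, hg, h⟩
        exact ⟨g⁻¹, inv_mem hg, by rw [← h, ← gaugeAct_mul, inv_mul_cancel, gaugeAct_one]⟩
      trans := by
        rintro A B C ⟨g, hg, h⟩ ⟨g', hg', h'⟩
        exact ⟨g' * g, mul_mem hg' hg, by rw [gaugeAct_mul, h, h']⟩ }

/-- Equivalence of Higgs fields under the adjoint action of `G'_τ(𝒪)`. -/
instance Higgs.setoid (r : k →ₗ[ZMod p] ZMod p) (G T : Subgroup (GL n k)) (τ : Matrix n n k) :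
    Setoid (Higgs r G T τ) where
  r φ ψ := ∃ g ∈ gaugeStabilizer G τ, adj g φ.form = ψ.form
  iseqv :=
    { refl := fun A => ⟨1, one_mem _, adj_one _⟩
      symm := by
        rintro A B ⟨g, hg, h⟩
        exact ⟨g⁻¹, inv_mem hg, by rw [← h, ← adj_mul, inv_mul_cancel, adj_one]⟩
      trans := by
        rintro A B C ⟨g, hg, h⟩ ⟨g', hg', h'⟩
        exact ⟨g' * g, mul_mem hg' hg, by rw [adj_mul, h, h']⟩ }

/-- `A` is in standard form and the rational part of its residue is `τ` itself. -/
def Locsys.IsNormalized (A : Locsys r G T τ) : Prop :=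
  IsStandardForm A.form ∧ HasRationalPart r G T (coeffMat 0 A.form) τ

end Categories

/-! ### Lie algebras over a general base, through dual numbers -/

section Tangent

set_option linter.unusedSectionVars false

variable {k : Type*} [Field k] {n : Type*} [Fintype n] [DecidableEq n]
  {R : Type*} [CommRing R] [Algebra k R]

/-! Write a horizontal map between the connections of two Higgs fields `φ`, `ψ` as a matrix `u`.
With `∇ u = z du/dz + u τ - τ u` and `K u = ψ u - u φ`, the gauge equation reads `∇ u = K u`. Since
`φ` and `ψ` are `∇`-horizontal, `∇` commutes with `K`. The eigenvalues of `∇` lie in the prime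
field, so `∇ ^ p = ∇` (`rationalConn_pow`), and therefore `(K ^ p - K) u = 0`. This polynomial is
the product of the `K - a` over `a ∈ 𝔽_p`. For `a ≠ 0` the factor `K - a` is injective, because the
eigenvalues of the residues of `φ` and `ψ` are killed by `r` while `r a = a`
(`eq_zero_of_intertwine`). Hence `K u = 0 = ∇ u`: every gauge transformation fixes `d + τ dz/z` and
carries `φ` to `ψ` by the adjoint action. This is fullness, and also injectivity on classes.

Essential surjectivity is the reduction to standard form. The coefficients are corrected one power
of `z` at a time: a gauge transformation `1 + x z ^ i + ...` changes `a_i` by `-([a_0, x] - i x)`,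
and Fitting's lemma on `𝔤` provides the `x` that leaves only the generalized eigencomponent. There
is no exponential in characteristic `p`; the required elements of `G(𝒪)` come from smoothness of
`G`, which lifts a tangent vector to a formal arc (`exists_arc`), followed by `z ↦ z ^ i`.

The two halves meet in `HasRationalPart.adLie_eq_smul`. On the generalized eigenspace of `[a_0, -]`
for `i`, differences of eigenvalues of the semisimple part equal `i`; applying `r` shows that `[τ,
-]` is multiplication by `i` there. So a connection in standard form with rational part `τ` is `τ`
plus a Higgs field. -/

theorem evalMat_map_algHom {S : Type*} [CommRing S] [Algebra k S] (φ : R →ₐ[k] S)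
    (f : MvPolynomial (n × n) k) (x : Matrix n n R) : evalMat f (x.map φ) = φ (evalMat f x) := by
  simp only [evalMat, ← AlgHom.comp_apply, MvPolynomial.comp_aeval]
  rfl

theorem map_mem_points {S : Type*} [CommRing S] [Algebra k S] (φ : R →ₐ[k] S)
    {G : Subgroup (GL n k)} {x : GL n R} (hx : x ∈ points R G) :
    Matrix.GeneralLinearGroup.map (φ : R →+* S) x ∈ points S G := by
  intro f hf
  have h := evalMat_map_algHom φ f (x : Matrix n n R)
  rw [hx f hf, map_zero] at h
  exact h

/-- The matrix `x + ε y` over the dual numbers. -/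
def dualMat (x y : Matrix n n R) : Matrix n n (DualNumber R) :=
  Matrix.of fun i j => TrivSqZeroExt.inl (x i j) + TrivSqZeroExt.inr (y i j)

/-- The directional derivative of a polynomial in the matrix entries at `x` along `y`. -/
noncomputable def dirDeriv (f : MvPolynomial (n × n) k) (x y : Matrix n n R) : R :=
  ∑ ij : n × n, evalMat (MvPolynomial.pderiv ij f) x * y ij.1 ij.2

/-- First-order Taylor expansion. It turns linear conditions on tangent vectors into membership in
the group of points over the dual numbers, where group operations can be used. -/
theorem evalMat_dualMat (f : MvPolynomial (n × n) k) (x y : Matrix n n R) :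
    (evalMat f (dualMat x y)).fst = evalMat f x ∧
      (evalMat f (dualMat x y)).snd = dirDeriv f x y := by
  induction f using MvPolynomial.induction_on with
  | C a => simp [evalMat, dirDeriv, TrivSqZeroExt.algebraMap_eq_inl']
  | add f g hf hg =>
    simp only [evalMat, dirDeriv, map_add, TrivSqZeroExt.fst_add, TrivSqZeroExt.snd_add, add_mul,
      Finset.sum_add_distrib] at hf hg ⊢
    exact ⟨by rw [hf.1, hg.1], by rw [hf.2, hg.2]⟩
  | mul_X f ij hf =>
    have h1 : evalMat (MvPolynomial.X ij : MvPolynomial (n × n) k) (dualMat x y)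
        = TrivSqZeroExt.inl (x ij.1 ij.2) + TrivSqZeroExt.inr (y ij.1 ij.2) := by
      simp [evalMat, dualMat]
    have h2 : evalMat (MvPolynomial.X ij : MvPolynomial (n × n) k) x = x ij.1 ij.2 := by
      simp [evalMat]
    rw [evalMat_mul, evalMat_mul, h1, h2]
    refine ⟨by rw [TrivSqZeroExt.fst_mul, hf.1]; simp, ?_⟩
    rw [TrivSqZeroExt.snd_mul, hf.1, hf.2]
    have h3 : ∀ l : n × n, evalMat (MvPolynomial.pderiv l (f * MvPolynomial.X ij)) x =
        evalMat (MvPolynomial.pderiv l f) x * x ij.1 ij.2 +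
          evalMat f x * (if ij = l then 1 else 0) := by
      intro l
      rw [MvPolynomial.pderiv_mul, MvPolynomial.pderiv_X]
      simp only [evalMat, map_add, map_mul, MvPolynomial.aeval_X, Pi.single_apply]
      split_ifs <;> simp_all
    simp only [dirDeriv, h3, add_mul, Finset.sum_add_distrib]
    simp only [mul_ite, mul_one, mul_zero, ite_mul, zero_mul, Finset.sum_ite_eq, Finset.mem_univ,
      if_true, smul_eq_mul, MulOpposite.smul_eq_mul_unop, MulOpposite.unop_op]
    rw [add_comm, Finset.sum_mul]
    refine congrArg₂ _ (Finset.sum_congr rfl fun l _ => ?_) (by simp)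
    simp only [TrivSqZeroExt.fst_add, TrivSqZeroExt.fst_inl, TrivSqZeroExt.fst_inr]
    ring

theorem dualMat_mul (x y x' y' : Matrix n n R) :
    dualMat x y * dualMat x' y' = dualMat (x * x') (x * y' + y * x') := by
  ext i j
  · simp only [dualMat, Matrix.mul_apply, Matrix.of_apply]
    exact (TrivSqZeroExt.fst_sum _ _).trans (by simp)
  · simp only [dualMat, Matrix.mul_apply, Matrix.of_apply]
    exact (TrivSqZeroExt.snd_sum _ _).trans
      (by simp [Matrix.mul_apply, ← Finset.sum_add_distrib, mul_comm])

theorem dualMat_one : dualMat (1 : Matrix n n R) 0 = 1 := by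
  ext i j <;> rcases eq_or_ne i j with rfl | h <;> simp [dualMat, *]

/-- The invertible matrix `x + ε y` over the dual numbers. -/
def dualUnit (x : GL n R) (y : Matrix n n R) : GL n (DualNumber R) where
  val := dualMat x y
  inv := dualMat ((x⁻¹ : GL n R) : Matrix n n R)
    (-(((x⁻¹ : GL n R) : Matrix n n R) * y * ((x⁻¹ : GL n R) : Matrix n n R)))
  val_inv := by
    rw [dualMat_mul, ← dualMat_one]
    congr 1
    · simp
    · simp [← mul_assoc]
  inv_val := by
    rw [dualMat_mul, ← dualMat_one]
    congr 1
    · simp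
    · simp [mul_assoc]

theorem dualUnit_mul (x x' : GL n R) (y y' : Matrix n n R) :
    dualUnit x y * dualUnit x' y' = dualUnit (x * x') (x * y' + y * x') :=
  Units.ext (dualMat_mul _ _ _ _)

theorem dualUnit_mem_points {G : Subgroup (GL n k)} {x : GL n R} {y : Matrix n n R} :
    dualUnit x y ∈ points (DualNumber R) G ↔
      x ∈ points R G ∧ ∀ f ∈ vanishing (G : Set (GL n k)), dirDeriv f (x : Matrix n n R) y = 0 := by
  constructor
  · intro h
    refine ⟨fun f hf => ?_, fun f hf => ?_⟩
    · rw [← (evalMat_dualMat f _ y).1]; exact congrArg TrivSqZeroExt.fst (h f hf)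
    · rw [← (evalMat_dualMat f _ y).2]; exact congrArg TrivSqZeroExt.snd (h f hf)
  · rintro ⟨h, h'⟩ f hf
    refine TrivSqZeroExt.ext ?_ ?_
    · exact (evalMat_dualMat f _ y).1.trans (h f hf)
    · exact (evalMat_dualMat f _ y).2.trans (h' f hf)

variable (G : Subgroup (GL n k))

/-- The Lie algebra of `G` with coefficients in a `k`-algebra `R`. -/
def IsTangent (X : Matrix n n R) : Prop :=
  ∀ f ∈ vanishing (G : Set (GL n k)), dirDeriv f (1 : Matrix n n R) X = 0

variable {G}

theorem isTangent_iff {X : Matrix n n R} :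
    IsTangent G X ↔ dualUnit 1 X ∈ points (DualNumber R) G :=
  ⟨fun h => dualUnit_mem_points.2 ⟨one_mem _, h⟩, fun h => (dualUnit_mem_points.1 h).2⟩

theorem dualUnit_zero_mem {x : GL n R} (hx : x ∈ points R G) :
    dualUnit x 0 ∈ points (DualNumber R) G :=
  dualUnit_mem_points.2 ⟨hx, fun f _ => by simp [dirDeriv]⟩

/-- Conjugate `1 + ε X` by `x` inside the group of points over the dual numbers. -/
theorem IsTangent.conj {x : GL n R} (hx : x ∈ points R G) {X : Matrix n n R}
    (hX : IsTangent G X) : IsTangent G ((x : Matrix n n R) * X * ((x⁻¹ : GL n R) : Matrix n n R)) := by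
  have h := mul_mem (mul_mem (dualUnit_zero_mem hx) (isTangent_iff.1 hX))
    (dualUnit_zero_mem (inv_mem hx))
  rw [dualUnit_mul, dualUnit_mul] at h
  rw [isTangent_iff]
  simpa using h

/-- Right translation by `x⁻¹` carries a tangent vector at `x` to one at the identity. -/
theorem isTangent_mul_inv {x : GL n R} {y : Matrix n n R}
    (h : dualUnit x y ∈ points (DualNumber R) G) : IsTangent G (y * ((x⁻¹ : GL n R) : Matrix n n R)) := by
  have h' := mul_mem h (dualUnit_zero_mem (inv_mem (dualUnit_mem_points.1 h).1))
  rw [dualUnit_mul] at h'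
  rw [isTangent_iff]
  simpa using h'

end Tangent

/-! ### Smoothness of linear algebraic groups and formal arcs -/

section Smoothness

set_option linter.unusedSectionVars false

/-- A nonzero reduced finitely presented algebra over a perfect field is smooth away from the zero
locus of some nonzero element. -/
theorem exists_smooth_localizationAway (k A : Type*) [Field k] [PerfectField k] [CommRing A]
    [Algebra k A] [Nontrivial A] [IsReduced A] [Algebra.FinitePresentation k A] :
    ∃ f : A, f ≠ 0 ∧ Algebra.Smooth k (Localization.Away f) := by
  -- At a minimal prime the local ring is reduced and its maximal ideal is nil, so it is a field.
  -- Being essentially of finite type over a perfect field, it is formally smooth, and smoothness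
  -- spreads to a neighbourhood.
  obtain ⟨p, hp⟩ := Ideal.nonempty_minimalPrimes (I := (⊥ : Ideal A)) bot_ne_top
  have : p.IsPrime := hp.1.1
  have hred : IsReduced (Localization.AtPrime p) :=
    isReduced_localizationPreserves p.primeCompl (Localization.AtPrime p) inferInstance
  have hm : IsField (Localization.AtPrime p) := by
    rw [IsLocalRing.isField_iff_maximalIdeal_eq]
    rw [← IsLocalization.AtPrime.map_eq_maximalIdeal p (Localization.AtPrime p),
      ← IsLocalization.AtPrime.radical_map_of_mem_minimalPrimes (A := Localization.AtPrime p) p ⊥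
        hp, Ideal.map_bot]
    exact nilradical_eq_zero _
  let : Field (Localization.AtPrime p) := hm.toField
  have : Algebra.EssFiniteType A (Localization.AtPrime p) :=
    Algebra.EssFiniteType.of_isLocalization _ p.primeCompl
  have : Algebra.EssFiniteType k (Localization.AtPrime p) := .comp _ A _
  have : Algebra.IsSmoothAt k p := Algebra.FormallySmooth.of_perfectField
  obtain ⟨f, hf, h⟩ := Algebra.IsSmoothAt.exists_notMem_smooth k p
  exact ⟨f, fun h0 => hf (h0 ▸ p.zero_mem), h⟩

/-- Completeness for this ideal lets a formally smooth algebra lift a map to `k⟦X⟧ / X ^ 2`, a copy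
of the dual numbers, to `k⟦X⟧` in one application. -/
instance PowerSeries.isAdicComplete_span_X_sq (k : Type*) [Field k] :
    IsAdicComplete (Ideal.span {(PowerSeries.X : k⟦X⟧) ^ 2}) k⟦X⟧ where
  haus' := by
    intro x hx
    ext i
    have h := hx (i + 1)
    rw [SModEq.zero, smul_eq_mul, Ideal.mul_top, Ideal.span_singleton_pow,
      Ideal.mem_span_singleton, ← pow_mul, PowerSeries.X_pow_dvd_iff] at h
    exact h i (by omega)
  prec' := by
    intro f hf
    have key : ∀ {a b : ℕ}, a ≤ b → ∀ i < 2 * a,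
        PowerSeries.coeff i (f a) = PowerSeries.coeff i (f b) := by
      intro a b hab i hi
      have h := hf hab
      rw [SModEq.sub_mem, smul_eq_mul, Ideal.mul_top, Ideal.span_singleton_pow,
        Ideal.mem_span_singleton, ← pow_mul, PowerSeries.X_pow_dvd_iff] at h
      simpa [sub_eq_zero] using h i hi
    refine ⟨PowerSeries.mk fun i => PowerSeries.coeff i (f (i + 1)), fun m => ?_⟩
    rw [SModEq.sub_mem, smul_eq_mul, Ideal.mul_top, Ideal.span_singleton_pow,
      Ideal.mem_span_singleton, ← pow_mul, PowerSeries.X_pow_dvd_iff]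
    intro i hi
    rw [map_sub, PowerSeries.coeff_mk, sub_eq_zero]
    rcases le_total m (i + 1) with h | h
    · exact key h i hi
    · exact (key h i (by omega)).symm

variable {k : Type*} [Field k] {n : Type*} [Fintype n] [DecidableEq n]

/-- The vanishing ideal of a set of invertible matrices. -/
def vanishingIdeal (S : Set (GL n k)) : Ideal (MvPolynomial (n × n) k) where
  carrier := vanishing S
  zero_mem' := fun g _ => by simp [evalMat]
  add_mem' := fun {a b} ha hb g hg => by
    have h1 := ha g hg
    have h2 := hb g hg
    simp only [evalMat] at h1 h2 ⊢
    rw [map_add, h1, h2, add_zero]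
  smul_mem' := fun c a ha g hg => by
    rw [smul_eq_mul, evalMat_mul, ha g hg, mul_zero]

instance (S : Set (GL n k)) : IsReduced (MvPolynomial (n × n) k ⧸ vanishingIdeal S) := by
  rw [← Ideal.isRadical_iff_quotient_reduced]
  rintro f ⟨N, hN⟩ g hg
  have h := hN g hg
  simp only [evalMat, map_pow] at h
  exact eq_zero_of_pow_eq_zero h

instance (G : Subgroup (GL n k)) :
    Nontrivial (MvPolynomial (n × n) k ⧸ vanishingIdeal (G : Set (GL n k))) := by
  refine Ideal.Quotient.nontrivial_iff.2 fun h => ?_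
  have h1 : (1 : MvPolynomial (n × n) k) ∈ vanishingIdeal (G : Set (GL n k)) := h ▸ trivial
  simpa [evalMat] using h1 1 G.one_mem

/-- The homomorphism from the coordinate ring given by a matrix which satisfies the equations. -/
noncomputable def coordHom {R : Type*} [CommRing R] [Algebra k R] {S : Set (GL n k)}
    (M : Matrix n n R) (hM : ∀ f ∈ vanishing S, evalMat f M = 0) :
    (MvPolynomial (n × n) k ⧸ vanishingIdeal S) →ₐ[k] R :=
  Ideal.Quotient.liftₐ (vanishingIdeal S) (MvPolynomial.aeval fun ij : n × n => M ij.1 ij.2) hM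

theorem const_mem_points {R : Type*} [CommRing R] [Algebra k R] {G : Subgroup (GL n k)}
    {g : GL n k} (hg : g ∈ G) :
    Matrix.GeneralLinearGroup.map (algebraMap k R) g ∈ points R G :=
  map_mem_points (Algebra.ofId k R) (fun _ hf => hf g hg)

instance (S : Set (GL n k)) :
    Algebra.FinitePresentation k (MvPolynomial (n × n) k ⧸ vanishingIdeal S) :=
  Algebra.FinitePresentation.of_finiteType.1 inferInstance

theorem coeffMat_mul_zero (A B : Matrix n n k⟦X⟧) :
    coeffMat 0 (A * B) = coeffMat 0 A * coeffMat 0 B := by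
  ext i j
  simp [coeffMat, Matrix.mul_apply]

theorem coeffMat_constMat_mul (i : ℕ) (a : Matrix n n k) (B : Matrix n n k⟦X⟧) :
    coeffMat i (constMat a * B) = a * coeffMat i B := by
  ext
  simp [coeffMat, constMat, Matrix.mul_apply]

theorem coeffMat_mul_constMat (i : ℕ) (a : Matrix n n k) (B : Matrix n n k⟦X⟧) :
    coeffMat i (B * constMat a) = coeffMat i B * a := by
  ext
  simp [coeffMat, constMat, Matrix.mul_apply]

theorem isUnit_of_coeffMat_zero {A : Matrix n n k⟦X⟧} (h : IsUnit (coeffMat 0 A)) :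
    IsUnit A := by
  rw [Matrix.isUnit_iff_isUnit_det, PowerSeries.isUnit_iff_constantCoeff, RingHom.map_det]
  rw [Matrix.isUnit_iff_isUnit_det] at h
  have h1 : coeffMat 0 A = PowerSeries.constantCoeff.mapMatrix A := by
    ext; simp [coeffMat]
  rwa [h1] at h

/-- A linear algebraic group over a perfect field is smooth: a tangent vector at the
identity is the velocity of a formal arc. -/
theorem exists_arc [PerfectField k] {G : Subgroup (GL n k)} {X : Matrix n n k}
    (hX : X ∈ lieAlg G) :
    ∃ γ ∈ points k⟦X⟧ G, coeffMat 0 (γ : Matrix n n k⟦X⟧) = 1 ∧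
      coeffMat 1 (γ : Matrix n n k⟦X⟧) = X := by
  obtain ⟨f, hf0, hf⟩ := exists_smooth_localizationAway k
    (MvPolynomial (n × n) k ⧸ vanishingIdeal (G : Set (GL n k)))
  obtain ⟨F, rfl⟩ := Ideal.Quotient.mk_surjective f
  have hF : F ∉ vanishingIdeal (G : Set (GL n k)) :=
    fun h => hf0 (Ideal.Quotient.eq_zero_iff_mem.2 h)
  -- Smoothness is known only where `F` does not vanish, so `X` is moved to a point `g` of that open
  -- set; the arc is translated back at the end.
  have hF' : ∃ g ∈ G, evalMat F (g : Matrix n n k) ≠ 0 := by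
    by_contra! h
    exact hF h
  obtain ⟨g, hg, hgF⟩ := hF'
  have hgR : g ∈ points k G := fun f hf => hf g hg
  have hM := mul_mem (dualUnit_zero_mem hgR) (isTangent_iff.1 (hX : IsTangent G X))
  rw [dualUnit_mul] at hM
  set Y := (g : Matrix n n k) * X with hY
  have hM' : dualUnit g Y ∈ points (DualNumber k) G := by simpa using hM
  let I : Ideal k⟦X⟧ := Ideal.span {(PowerSeries.X : k⟦X⟧) ^ 2}
  let ψ : DualNumber k →ₐ[k] k⟦X⟧ ⧸ I := DualNumber.lift ⟨(Algebra.ofId k _,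
    Ideal.Quotient.mk I PowerSeries.X), by
      rw [← map_mul, Ideal.Quotient.eq_zero_iff_mem, ← pow_two]
      exact Ideal.mem_span_singleton_self _, fun a => Commute.all _ _⟩
  let α := coordHom (S := (G : Set (GL n k))) (dualMat (g : Matrix n n k) Y) hM'
  -- The value of `F` at `g + ε Y` is a unit because its constant term `F(g)` is nonzero, so the
  -- tangent vector factors through the smooth localization.
  have hu : IsUnit (α (Ideal.Quotient.mk _ F)) := by
    rw [TrivSqZeroExt.isUnit_iff_isUnit_fst]
    change IsUnit (evalMat F (dualMat (g : Matrix n n k) Y)).fst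
    rw [(evalMat_dualMat F _ _).1]
    exact hgF.isUnit
  let β : Localization.Away (Ideal.Quotient.mk (vanishingIdeal (G : Set (GL n k))) F) →ₐ[k]
      DualNumber k := IsLocalization.Away.liftAlgHom (f := α) _ hu
  -- Infinitesimal lifting, with `ε` corresponding to `z` modulo `z ^ 2`.
  obtain ⟨δ, hδ⟩ := Algebra.FormallySmooth.exists_mkₐ_comp_eq_of_isAdicComplete (ψ.comp β)
  let ι := IsScalarTower.toAlgHom k (MvPolynomial (n × n) k ⧸ vanishingIdeal (G : Set (GL n k)))
    (Localization.Away (Ideal.Quotient.mk (vanishingIdeal (G : Set (GL n k))) F))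
  let η : MvPolynomial (n × n) k →ₐ[k] k⟦X⟧ := (δ.comp ι).comp (Ideal.Quotient.mkₐ k _)
  have hη : ∀ f, Ideal.Quotient.mk I (η f) = ψ (evalMat f (dualMat (g : Matrix n n k) Y)) := by
    intro f
    refine (AlgHom.congr_fun hδ (ι (Ideal.Quotient.mk _ f))).trans (congrArg ψ ?_)
    exact IsLocalization.Away.lift_eq _ hu _
  let Γ : Matrix n n k⟦X⟧ := Matrix.of fun i j => η (MvPolynomial.X (i, j))
  have hΓ : ∀ f ∈ vanishing (G : Set (GL n k)), evalMat f Γ = 0 := by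
    intro f hf
    have h1 : evalMat f Γ = η f := AlgHom.congr_fun (MvPolynomial.aeval_unique η).symm f
    have h2 : (Ideal.Quotient.mk (vanishingIdeal (G : Set (GL n k))) f) = 0 :=
      Ideal.Quotient.eq_zero_iff_mem.2 hf
    rw [h1]
    exact (congrArg (δ.comp ι) h2).trans (map_zero _)
  have hcoeff : ∀ i j, PowerSeries.coeff 0 (Γ i j) = g i j ∧ PowerSeries.coeff 1 (Γ i j) = Y i j := by
    intro i j
    have h1 : Ideal.Quotient.mk I (Γ i j) =
        Ideal.Quotient.mk I (PowerSeries.C (g i j) + PowerSeries.C (Y i j) * PowerSeries.X) := by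
      refine (hη _).trans ?_
      simp only [evalMat, MvPolynomial.aeval_X]
      simp only [ψ, DualNumber.lift_apply_apply, dualMat, Matrix.of_apply,
        TrivSqZeroExt.fst_inl, TrivSqZeroExt.fst_inr, TrivSqZeroExt.snd_inl,
        TrivSqZeroExt.snd_inr, map_zero, zero_mul, add_zero, zero_add, map_add, map_mul]
      rfl
    rw [Ideal.Quotient.eq, Ideal.mem_span_singleton, PowerSeries.X_pow_dvd_iff] at h1
    have h2 := h1 0 (by norm_num)
    have h3 := h1 1 (by norm_num)
    rw [map_sub, sub_eq_zero] at h2 h3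
    constructor
    · rw [h2]; simp
    · rw [h3, map_add, PowerSeries.coeff_C, ← zero_add 1, PowerSeries.coeff_succ_mul_X]; simp
  have h0 : coeffMat 0 Γ = g := Matrix.ext fun i j => (hcoeff i j).1
  have h1 : coeffMat 1 Γ = Y := Matrix.ext fun i j => (hcoeff i j).2
  obtain ⟨u, hu⟩ := isUnit_of_coeffMat_zero (h0 ▸ g.isUnit)
  have hmem : u ∈ points k⟦X⟧ G := fun f hf => by rw [hu]; exact hΓ f hf
  refine ⟨_, mul_mem (const_mem_points (R := k⟦X⟧) (G.inv_mem hg)) hmem, ?_, ?_⟩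
  · refine (coeffMat_constMat_mul 0 ((g⁻¹ : GL n k) : Matrix n n k) _).trans ?_
    rw [hu, h0]; exact g.inv_mul
  · refine (coeffMat_constMat_mul 1 ((g⁻¹ : GL n k) : Matrix n n k) _).trans ?_
    rw [hu, h1, hY, ← mul_assoc, g.inv_mul, one_mul]

end Smoothness

/-! ### Coefficients of matrix power series and the loop algebra -/

section LoopAlgebra

set_option linter.unusedSectionVars false

variable {k : Type*} [Field k] {n : Type*} [Fintype n] [DecidableEq n]

theorem coeffMat_mul (i : ℕ) (A B : Matrix n n k⟦X⟧) :
    coeffMat i (A * B) =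
      ∑ ab ∈ Finset.HasAntidiagonal.antidiagonal i, coeffMat ab.1 A * coeffMat ab.2 B := by
  ext a b
  simp only [coeffMat, Matrix.map_apply, Matrix.mul_apply, map_sum, PowerSeries.coeff_mul,
    Matrix.sum_apply]
  rw [Finset.sum_comm]

theorem coeffMat_add (i : ℕ) (A B : Matrix n n k⟦X⟧) :
    coeffMat i (A + B) = coeffMat i A + coeffMat i B := by
  ext; simp [coeffMat]

theorem coeffMat_sub (i : ℕ) (A B : Matrix n n k⟦X⟧) :
    coeffMat i (A - B) = coeffMat i A - coeffMat i B := by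
  ext; simp [coeffMat]

theorem coeffMat_constMat (i : ℕ) (a : Matrix n n k) :
    coeffMat i (constMat a) = if i = 0 then a else 0 := by
  ext
  simp only [coeffMat, constMat, Matrix.map_apply, PowerSeries.coeff_C]
  split_ifs <;> simp

theorem coeffMat_one (i : ℕ) :
    coeffMat i (1 : Matrix n n k⟦X⟧) = if i = 0 then 1 else 0 := by
  rw [← coeffMat_constMat, constMat, Matrix.map_one _ (map_zero _) (map_one _)]

theorem coeffMat_eulerMat (i : ℕ) (A : Matrix n n k⟦X⟧) :
    coeffMat i (eulerMat A) = (i : k) • coeffMat i A := by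
  ext a b
  simp only [coeffMat, eulerMat, Matrix.map_apply, Matrix.smul_apply, smul_eq_mul]
  cases i with
  | zero => simp
  | succ i => rw [PowerSeries.coeff_succ_X_mul, PowerSeries.coeff_derivative]; push_cast; ring

theorem coeffMat_ext {A B : Matrix n n k⟦X⟧} (h : ∀ i, coeffMat i A = coeffMat i B) : A = B := by
  ext a b i
  exact congrFun (congrFun (h i) a) b

/-- The linear equations of the tangent space have coefficients in `k`, so they hold for a power
series exactly when they hold for each coefficient. -/
theorem mem_loopAlg_iff {G : Subgroup (GL n k)} {A : Matrix n n k⟦X⟧} :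
    A ∈ loopAlg G ↔ IsTangent G A := by
  have h1 : ∀ f : MvPolynomial (n × n) k, evalMat f (1 : Matrix n n k⟦X⟧) =
      algebraMap k k⟦X⟧ (evalMat f (1 : Matrix n n k)) := by
    intro f
    rw [← evalMat_map_algebraMap, Matrix.map_one _ (map_zero _) (map_one _)]
  have h2 : ∀ (f : MvPolynomial (n × n) k) (i : ℕ), PowerSeries.coeff i (dirDeriv f 1 A) =
      ∑ ij : n × n, evalMat (MvPolynomial.pderiv ij f) (1 : Matrix n n k) *
        coeffMat i A ij.1 ij.2 := by
    intro f i
    simp only [dirDeriv, h1, map_sum]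
    refine Finset.sum_congr rfl fun ij _ => ?_
    exact PowerSeries.coeff_C_mul _ _ _
  constructor
  · intro h f hf
    ext i
    rw [h2, h i f hf, map_zero]
  · intro h i f hf
    rw [← h2, h f hf, map_zero]

/-- The homomorphism `f ↦ f + ε z f'`. -/
noncomputable def eulerHom (k : Type*) [Field k] : k⟦X⟧ →ₐ[k] DualNumber k⟦X⟧ where
  toFun f := TrivSqZeroExt.inl f +
    TrivSqZeroExt.inr (PowerSeries.X * PowerSeries.derivative k f)
  map_one' := by ext <;> simp
  map_mul' f g := by
    refine TrivSqZeroExt.ext (by simp) ?_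
    simp only [TrivSqZeroExt.snd_add, TrivSqZeroExt.snd_inl, TrivSqZeroExt.snd_inr,
      TrivSqZeroExt.snd_mul, TrivSqZeroExt.fst_add, TrivSqZeroExt.fst_inl, TrivSqZeroExt.fst_inr,
      Derivation.leibniz, smul_eq_mul, MulOpposite.smul_eq_mul_unop, MulOpposite.unop_op]
    ring
  map_zero' := by ext <;> simp
  map_add' f g := by
    refine TrivSqZeroExt.ext (by simp) ?_
    simp [mul_add]
  commutes' c := by
    refine TrivSqZeroExt.ext ?_ ?_ <;> simp [TrivSqZeroExt.algebraMap_eq_inl']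

/-- Applying the algebra homomorphism `eulerHom` to the entries of `g` gives a point `g + ε z g'` of
`G`; this is why the inhomogeneous term of the gauge action stays in `𝔤(𝒪)`. -/
theorem isTangent_eulerMat_mul_inv {G : Subgroup (GL n k)} {g : GL n k⟦X⟧}
    (hg : g ∈ points k⟦X⟧ G) :
    IsTangent G (eulerMat (g : Matrix n n k⟦X⟧) * ((g⁻¹ : GL n k⟦X⟧) : Matrix n n k⟦X⟧)) := by
  refine isTangent_mul_inv ?_
  have h := map_mem_points (eulerHom k) hg
  have h1 : dualUnit g (eulerMat (g : Matrix n n k⟦X⟧)) =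
      Matrix.GeneralLinearGroup.map (eulerHom k : k⟦X⟧ →+* DualNumber k⟦X⟧) g := by
    ext1; rfl
  rwa [h1]

theorem IsTangent.add {R : Type*} [CommRing R] [Algebra k R] {G : Subgroup (GL n k)}
    {A B : Matrix n n R} (hA : IsTangent G A) (hB : IsTangent G B) : IsTangent G (A + B) := by
  intro f hf
  have h1 := hA f hf
  have h2 := hB f hf
  simp only [dirDeriv, Matrix.add_apply, mul_add, Finset.sum_add_distrib] at h1 h2 ⊢
  rw [h1, h2, add_zero]

theorem adj_mem_loopAlg {G : Subgroup (GL n k)} {g : GL n k⟦X⟧} (hg : g ∈ points k⟦X⟧ G)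
    {A : Matrix n n k⟦X⟧} (hA : A ∈ loopAlg G) : adj g A ∈ loopAlg G :=
  mem_loopAlg_iff.2 ((mem_loopAlg_iff.1 hA).conj hg)

theorem gaugeAct_mem_loopAlg {G : Subgroup (GL n k)} {g : GL n k⟦X⟧} (hg : g ∈ points k⟦X⟧ G)
    {A : Matrix n n k⟦X⟧} (hA : A ∈ loopAlg G) : gaugeAct g A ∈ loopAlg G :=
  mem_loopAlg_iff.2 ((isTangent_eulerMat_mul_inv hg).add ((mem_loopAlg_iff.1 hA).conj hg))

theorem constMat_mem_loopAlg {G : Subgroup (GL n k)} {x : Matrix n n k} (hx : x ∈ lieAlg G) :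
    constMat x ∈ loopAlg G := by
  intro i
  rw [coeffMat_constMat]
  split_ifs
  exacts [hx, zero_mem _]

theorem conj_mem_lieAlg {G : Subgroup (GL n k)} {g : GL n k} (hg : g ∈ G) {x : Matrix n n k}
    (hx : x ∈ lieAlg G) : (g : Matrix n n k) * x * ((g⁻¹ : GL n k) : Matrix n n k) ∈ lieAlg G :=
  IsTangent.conj (G := G) (fun _ hf => hf g hg) (X := x) hx

theorem lieAlg_mono {G H : Subgroup (GL n k)} (h : G ≤ H) : lieAlg G ≤ lieAlg H :=
  fun _ hx f hf => hx f fun g hg => hf g (h hg)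

theorem adLie_apply (a x : Matrix n n k) : adLie a x = a * x - x * a := rfl

/-- For an arc `γ = 1 + a z + ...` in `G`, the coefficient of `z` in `Ad(γ) x` is `[a, x]`, and
`Ad(γ) x` lies in `𝔤(𝒪)`. -/
theorem adLie_mem_lieAlg [PerfectField k] {G : Subgroup (GL n k)} {a x : Matrix n n k}
    (ha : a ∈ lieAlg G) (hx : x ∈ lieAlg G) : adLie a x ∈ lieAlg G := by
  obtain ⟨γ, hγ, h0, h1⟩ := exists_arc ha
  have hZ := adj_mem_loopAlg hγ (constMat_mem_loopAlg hx)
  have h2 : adj γ (constMat x) * (γ : Matrix n n k⟦X⟧) = γ * constMat x := by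
    rw [adj, mul_assoc, γ.inv_mul, mul_one]
  have h3 := congrArg (coeffMat 0) h2
  have h4 := congrArg (coeffMat 1) h2
  rw [coeffMat_mul_zero, h0, coeffMat_mul_constMat, h0, mul_one, one_mul] at h3
  have hanti : Finset.HasAntidiagonal.antidiagonal 1 = {((0 : ℕ), (1 : ℕ)), (1, 0)} := rfl
  rw [coeffMat_mul, coeffMat_mul_constMat, hanti, Finset.sum_pair (by simp), h0, h1, h3,
    mul_one] at h4
  rw [adLie_apply, ← h4, add_sub_cancel_left]
  exact hZ 1

end LoopAlgebra

/-! ### Cocharacters, their differentials, and the splitting -/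

section Cocharacters

set_option linter.unusedSectionVars false

variable {k : Type*} [Field k]

/-- The character `t ↦ t ^ m` of the multiplicative group. -/
def powChar (k : Type*) [Field k] (m : ℤ) : kˣ →* k :=
  (Units.coeHom k).comp (zpowGroupHom m)

/-- If two exponents gave the same character, `X ^ (d + 1)` and `X` would agree as functions on an
infinite field, with `d` the absolute difference. -/
theorem powChar_injective [Infinite k] : Function.Injective (powChar k) := by
  intro a b hab
  have key : ∀ d : ℕ, (∀ t : kˣ, t ^ d = 1) → d = 0 := by
    intro d hd
    by_contra hd0
    have h : (Polynomial.X ^ (d + 1) : Polynomial k) = Polynomial.X := by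
      refine Polynomial.funext fun x => ?_
      rcases eq_or_ne x 0 with rfl | hx
      · simp
      · have := congrArg Units.val (hd (Units.mk0 x hx))
        simp only [Units.val_pow_eq_pow_val, Units.val_mk0, Units.val_one] at this
        simp [pow_succ, this]
    have := congrArg Polynomial.natDegree h
    simp at this
    exact hd0 this
  have h : ∀ t : kˣ, t ^ (a - b) = 1 := by
    intro t
    have h1 : t ^ a = t ^ b := Units.ext (DFunLike.congr_fun hab t)
    rw [zpow_sub, h1, mul_inv_cancel]
  have h2 : ∀ t : kˣ, t ^ (a - b).natAbs = 1 := by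
    intro t
    rcases Int.natAbs_eq (a - b) with h3 | h3
    · have := h t
      rwa [h3, zpow_natCast] at this
    · have := h t
      rwa [h3, zpow_neg, inv_eq_one, zpow_natCast] at this
  have := key _ h2
  omega

/-- Presents a Laurent polynomial function as a combination of characters, so that Dedekind
independence applies. -/
theorem linearCombination_powChar (c : ℤ →₀ k) (t : kˣ) :
    Finsupp.linearCombination k (fun f : kˣ →* k => (f : kˣ → k)) (c.mapDomain (powChar k)) t =
      c.sum fun m a => ((t ^ m : kˣ) : k) * a := by
  rw [Finsupp.linearCombination_mapDomain, Finsupp.linearCombination_apply, Finsupp.sum,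
    Finset.sum_apply, Finsupp.sum]
  exact Finset.sum_congr rfl fun m _ => mul_comm _ _

/-- A Laurent polynomial function on `kˣ` vanishes only if its coefficients do. -/
theorem finsupp_eq_zero_of_sum_powChar [Infinite k] (c : ℤ →₀ k)
    (h : ∀ t : kˣ, (c.sum fun m a => ((t ^ m : kˣ) : k) * a) = 0) : c = 0 := by
  have h1 : c.mapDomain (powChar k) = 0 := by
    refine linearIndependent_iff.1 (linearIndependent_monoidHom kˣ k) _ ?_
    ext t
    rw [linearCombination_powChar, h t, Pi.zero_apply]
  exact Finsupp.mapDomain_injective (powChar_injective (k := k)) (by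
    rw [h1, Finsupp.mapDomain_zero])

/-- A multiplicative Laurent polynomial function on `kˣ` is a monomial. -/
theorem exists_eq_single_of_sum_powChar [Infinite k] (c : ℤ →₀ k) (χ : kˣ →* k)
    (h : ∀ t : kˣ, χ t = c.sum fun m a => ((t ^ m : kˣ) : k) * a) :
    ∃ m : ℤ, c = Finsupp.single m 1 := by
  have h1 : Finsupp.single χ (1 : k) = c.mapDomain (powChar k) := by
    refine (linearIndependent_monoidHom kˣ k) ?_
    ext t
    rw [linearCombination_powChar, Finsupp.linearCombination_single, one_smul, h t]
  have h2 : χ ∈ Set.range (powChar k) := by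
    by_contra hχ
    have h3 := DFunLike.congr_fun h1 χ
    rw [Finsupp.mapDomain_of_notMem_range _ _ hχ] at h3
    simp at h3
  obtain ⟨m, rfl⟩ := h2
  refine ⟨m, Finsupp.mapDomain_injective (powChar_injective (k := k)) ?_⟩
  rw [← h1, Finsupp.mapDomain_single]

/-- Evaluation of Laurent polynomials at a unit. -/
noncomputable def laurentEval {R : Type*} [CommRing R] [Algebra k R] (u : Rˣ) :
    AddMonoidAlgebra k ℤ →ₐ[k] R :=
  AddMonoidAlgebra.lift k R ℤ ((Units.coeHom R).comp (zpowersHom Rˣ u))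

theorem laurentEval_apply {R : Type*} [CommRing R] [Algebra k R] (u : Rˣ)
    (c : AddMonoidAlgebra k ℤ) :
    laurentEval u c = c.coeff.sum fun m a => a • ((u ^ m : Rˣ) : R) :=
  AddMonoidAlgebra.lift_apply _ _

/-- The homomorphism `a ↦ 1 + ε a` to the units of the dual numbers. -/
def dualExp (k : Type*) [Field k] : Multiplicative k →* DualNumber k where
  toFun a := TrivSqZeroExt.inl 1 + TrivSqZeroExt.inr a.toAdd
  map_one' := by ext <;> simp
  map_mul' a b := by
    ext
    · simp
    · simp [add_comm]

variable {n : Type*} [Fintype n] [DecidableEq n] {T : Subgroup (GL n k)}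

namespace Cocharacter

/-- The matrix of Laurent polynomials given by a cocharacter. -/
noncomputable def laurentMat (ϑ : Cocharacter T) : Matrix n n (AddMonoidAlgebra k ℤ) :=
  Matrix.of fun i j => AddMonoidAlgebra.ofCoeff (ϑ.coeff.mapRange (fun C => C i j) rfl)

theorem laurentEval_laurentMat {R : Type*} [CommRing R] [Algebra k R] (ϑ : Cocharacter T) (u : Rˣ)
    (i j : n) :
    laurentEval u (ϑ.laurentMat i j) = ϑ.coeff.sum fun m C => C i j • ((u ^ m : Rˣ) : R) := by
  rw [laurentEval_apply]
  exact Finsupp.sum_mapRange_index (hf := rfl) fun _ => zero_smul _ _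

theorem hom_apply (ϑ : Cocharacter T) (t : kˣ) (i j : n) :
    ϑ.hom t i j = ϑ.coeff.sum fun m C => ((t ^ m : kˣ) : k) * C i j := by
  rw [ϑ.hom_eq t, Finsupp.sum, Matrix.sum_apply]
  rfl

theorem differential_apply (ϑ : Cocharacter T) (i j : n) :
    ϑ.differential i j = ϑ.coeff.sum fun m C => (m : k) * C i j := by
  rw [differential, Finsupp.sum, Matrix.sum_apply]
  rfl

/-- An equation of `T` pulled back along the cocharacter is a Laurent polynomial vanishing on `kˣ`,
hence zero; it may then be evaluated at the unit `1 + ε`, where the cocharacter takes the value `1 +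
ε dϑ(1)`. -/
theorem differential_mem_lieAlg [Infinite k] (ϑ : Cocharacter T) :
    ϑ.differential ∈ lieAlg T := by
  change IsTangent T ϑ.differential
  rw [isTangent_iff]
  intro f hf
  have h0 : evalMat f ϑ.laurentMat = 0 := by
    have h1 : (evalMat f ϑ.laurentMat).coeff = 0 := by
      refine finsupp_eq_zero_of_sum_powChar _ fun t => ?_
      have h2 := evalMat_map_algHom (laurentEval (R := k) t) f ϑ.laurentMat
      have h3 : ϑ.laurentMat.map (laurentEval (R := k) t) = ϑ.hom t := by
        ext i j
        rw [Matrix.map_apply, laurentEval_laurentMat, hom_apply]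
        exact Finset.sum_congr rfl fun m _ => mul_comm _ _
      rw [h3, hf _ (ϑ.mem t), laurentEval_apply] at h2
      rw [h2]
      exact Finset.sum_congr rfl fun m _ => mul_comm _ _
    exact AddMonoidAlgebra.coeff_injective h1
  let u := (dualExp k).toHomUnits (Multiplicative.ofAdd 1)
  have hu : ∀ m : ℤ, ((u ^ m : (DualNumber k)ˣ) : DualNumber k) =
      TrivSqZeroExt.inl 1 + TrivSqZeroExt.inr (m : k) := by
    intro m
    rw [← map_zpow, MonoidHom.coe_toHomUnits, ← ofAdd_zsmul, zsmul_one]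
    rfl
  have h2 := evalMat_map_algHom (laurentEval (R := DualNumber k) u) f ϑ.laurentMat
  have h3 : ϑ.laurentMat.map (laurentEval (R := DualNumber k) u) = dualMat 1 ϑ.differential := by
    have h4 : (1 : Matrix n n k) = ϑ.hom 1 := by rw [map_one]; rfl
    ext i j
    · rw [Matrix.map_apply, laurentEval_laurentMat, Finsupp.sum]
      refine (TrivSqZeroExt.fst_sum _ _).trans ?_
      simp only [dualMat, h4, hom_apply, Matrix.of_apply, hu]
      simp [Finsupp.sum]
    · rw [Matrix.map_apply, laurentEval_laurentMat, Finsupp.sum]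
      refine (TrivSqZeroExt.snd_sum _ _).trans ?_
      simp only [dualMat, differential_apply, Matrix.of_apply, hu]
      simp [Finsupp.sum, mul_comm]
  rw [h3, h0, map_zero] at h2
  exact h2

/-- In a basis diagonalizing `T`, each diagonal entry of the cocharacter is a multiplicative Laurent
polynomial, hence some `t ^ m`, with derivative `m` at `t = 1`. This puts the eigenvalues of the
differential in the prime field. -/
theorem exists_diagonal [Infinite k] (ϑ : Cocharacter T) {P : GL n k}
    (hP : ∀ t ∈ T, ((P * t * P⁻¹ : GL n k) : Matrix n n k).IsDiag) :
    ∃ m : n → ℤ, (P : Matrix n n k) * ϑ.differential * ((P⁻¹ : GL n k) : Matrix n n k) =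
      Matrix.diagonal fun i => (m i : k) := by
  let φ : Matrix n n k →ₗ[k] Matrix n n k :=
    LinearMap.mulRight k ((P⁻¹ : GL n k) : Matrix n n k) ∘ₗ LinearMap.mulLeft k (P : Matrix n n k)
  have hφ : ∀ M, φ M = (P : Matrix n n k) * M * ((P⁻¹ : GL n k) : Matrix n n k) := fun _ => rfl
  let D : n → n → ℤ →₀ k := fun i j => ϑ.coeff.mapRange (fun C => φ C i j) (by simp)
  have hD : ∀ (t : kˣ) i j, (P * ϑ.hom t * P⁻¹ : GL n k) i j =
      (D i j).sum fun m a => ((t ^ m : kˣ) : k) * a := by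
    intro t i j
    rw [Finsupp.sum_mapRange_index fun _ => mul_zero _]
    have h : ((P * ϑ.hom t * P⁻¹ : GL n k) : Matrix n n k) = φ (ϑ.hom t : Matrix n n k) := rfl
    rw [h, ϑ.hom_eq t, Finsupp.sum, map_sum, Matrix.sum_apply]
    refine Finset.sum_congr rfl fun m _ => ?_
    rw [map_smul]
    rfl
  have hdiff : ∀ i j, φ ϑ.differential i j = (D i j).sum fun m a => (m : k) * a := by
    intro i j
    rw [Finsupp.sum_mapRange_index fun _ => mul_zero _, differential, Finsupp.sum, map_sum,
      Matrix.sum_apply]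
    refine Finset.sum_congr rfl fun m _ => ?_
    rw [map_smul]
    rfl
  have hoff : ∀ i j, i ≠ j → D i j = 0 := by
    intro i j hij
    refine finsupp_eq_zero_of_sum_powChar _ fun t => ?_
    rw [← hD]
    exact hP _ (ϑ.mem t) hij
  have hon : ∀ i, ∃ m : ℤ, D i i = Finsupp.single m 1 := by
    intro i
    refine exists_eq_single_of_sum_powChar (D i i)
      { toFun := fun t => (P * ϑ.hom t * P⁻¹ : GL n k) i i
        map_one' := by simp
        map_mul' := fun s t => ?_ } fun t => hD t i i
    have h1 : P * ϑ.hom (s * t) * P⁻¹ = (P * ϑ.hom s * P⁻¹) * (P * ϑ.hom t * P⁻¹) := by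
      rw [map_mul]; group
    rw [h1, Units.val_mul, Matrix.mul_apply]
    refine Finset.sum_eq_single i (fun j _ hj => ?_) (by simp)
    rw [hP _ (ϑ.mem s) hj.symm, zero_mul]
  choose m hm using hon
  refine ⟨m, Matrix.ext fun i j => ?_⟩
  rw [← hφ, hdiff]
  rcases eq_or_ne i j with rfl | hij
  · simp [hm]
  · simp [hoff i j hij, hij]

end Cocharacter

variable {p : ℕ} [Fact p.Prime] [Algebra (ZMod p) k] {r : k →ₗ[ZMod p] ZMod p}

theorem exists_diagonal_of_mem_rationalPoints [Infinite k] {P : GL n k}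
    (hP : ∀ t ∈ T, ((P * t * P⁻¹ : GL n k) : Matrix n n k).IsDiag) {x : Matrix n n k}
    (hx : x ∈ rationalPoints T) :
    ∃ d : n → ℤ, (P : Matrix n n k) * x * ((P⁻¹ : GL n k) : Matrix n n k) =
      Matrix.diagonal fun i => (d i : k) := by
  induction hx using AddSubgroup.closure_induction with
  | mem x hx => obtain ⟨ϑ, rfl⟩ := hx; exact ϑ.exists_diagonal hP
  | zero => exact ⟨0, by ext; simp [Matrix.diagonal_apply]⟩
  | add x y _ _ hx hy =>
    obtain ⟨d, hd⟩ := hx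
    obtain ⟨e, he⟩ := hy
    exact ⟨d + e, by rw [mul_add, add_mul, hd, he, Matrix.diagonal_add]; simp⟩
  | neg x _ hx =>
    obtain ⟨d, hd⟩ := hx
    exact ⟨-d, by rw [mul_neg, neg_mul, hd, Matrix.diagonal_neg]; simp⟩

theorem rationalPoints_le_lieAlg [Infinite k] :
    rationalPoints T ≤ (lieAlg T).toAddSubgroup := by
  rw [rationalPoints, AddSubgroup.closure_le]
  rintro _ ⟨ϑ, rfl⟩
  exact ϑ.differential_mem_lieAlg

namespace SplittingMapsTo

theorem add {s τ s' τ' : Matrix n n k} (h : SplittingMapsTo r T s τ)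
    (h' : SplittingMapsTo r T s' τ') : SplittingMapsTo r T (s + s') (τ + τ') := by
  obtain ⟨m, ϑ, c, rfl, rfl⟩ := h
  obtain ⟨m', ϑ', c', rfl, rfl⟩ := h'
  refine ⟨m + m', Fin.append ϑ ϑ', Fin.append c c', ?_, ?_⟩ <;> simp [Fin.sum_univ_add]

theorem neg {s τ : Matrix n n k} (h : SplittingMapsTo r T s τ) :
    SplittingMapsTo r T (-s) (-τ) := by
  obtain ⟨m, ϑ, c, rfl, rfl⟩ := h
  exact ⟨m, ϑ, -c, by simp, by simp⟩

theorem of_mem_rationalPoints (hr : r 1 = 1) {x : Matrix n n k} (hx : x ∈ rationalPoints T) :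
    SplittingMapsTo r T x x := by
  induction hx using AddSubgroup.closure_induction with
  | mem x hx =>
    obtain ⟨ϑ, rfl⟩ := hx
    exact ⟨1, fun _ => ϑ, fun _ => 1, by simp, by simp [hr]⟩
  | zero => exact ⟨0, Fin.elim0, Fin.elim0, by simp, by simp⟩
  | add x y _ _ hx hy => exact hx.add hy
  | neg x _ hx => exact hx.neg

theorem mem_rationalPoints {s τ : Matrix n n k} (h : SplittingMapsTo r T s τ) :
    τ ∈ rationalPoints T := by
  obtain ⟨m, ϑ, c, -, rfl⟩ := h
  refine sum_mem fun i _ => ?_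
  -- A scalar of `𝔽_p` acts as a natural multiple, so the term stays in the additive subgroup
  -- generated by the differentials.
  rw [← ZMod.natCast_zmod_val (r (c i)), map_natCast, Nat.cast_smul_eq_nsmul]
  exact nsmul_mem (AddSubgroup.subset_closure (Set.mem_range_self (ϑ i))) _

theorem sub_self (hr : r 1 = 1) {s τ : Matrix n n k} (h : SplittingMapsTo r T s τ) :
    SplittingMapsTo r T (s - τ) 0 := by
  simpa [sub_eq_add_neg] using h.add (of_mem_rationalPoints hr h.mem_rationalPoints).neg

/-- Since the weights are integers and `r` is additive, the splitting becomes entrywise application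
of `r` on the diagonal. In particular `τ` depends on `s` alone, not on the chosen presentation by
cocharacters. -/
theorem exists_diagonal [Infinite k] {P : GL n k}
    (hP : ∀ t ∈ T, ((P * t * P⁻¹ : GL n k) : Matrix n n k).IsDiag) {s τ : Matrix n n k}
    (h : SplittingMapsTo r T s τ) :
    ∃ σ : n → k,
      (P : Matrix n n k) * s * ((P⁻¹ : GL n k) : Matrix n n k) = Matrix.diagonal σ ∧
      (P : Matrix n n k) * τ * ((P⁻¹ : GL n k) : Matrix n n k) =
        Matrix.diagonal fun i => algebraMap (ZMod p) k (r (σ i)) := by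
  obtain ⟨m, ϑ, c, rfl, rfl⟩ := h
  choose d hd using fun i => (ϑ i).exists_diagonal hP
  refine ⟨fun a => ∑ i, c i * (d i a : k), ?_, ?_⟩
  · simp only [Finset.mul_sum, Finset.sum_mul, mul_smul_comm, smul_mul_assoc, hd]
    ext a b
    rcases eq_or_ne a b with rfl | hab
    · simp [Matrix.sum_apply]
    · simp [Matrix.sum_apply, hab]
  · simp only [Finset.mul_sum, Finset.sum_mul, mul_smul_comm, smul_mul_assoc, hd]
    have hr' : ∀ (x : k) (z : ℤ), r (x * (z : k)) = r x * (z : ZMod p) := by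
      intro x z
      rw [mul_comm, ← zsmul_eq_mul, map_zsmul, zsmul_eq_mul, mul_comm]
    ext a b
    rcases eq_or_ne a b with rfl | hab
    · simp [Matrix.sum_apply, hr', Algebra.smul_def, Matrix.algebraMap_matrix_apply]
    · simp [Matrix.sum_apply, hab]

end SplittingMapsTo

end Cocharacters

/-! ### Intertwiners and horizontality for the rational part -/

section Fullness

set_option linter.unusedSectionVars false

variable {k : Type*} [Field k] {n : Type*} [Fintype n] [DecidableEq n]

open Polynomial in
theorem aeval_mul_eq_mul_aeval {A : Type*} [Ring A] [Algebra k A] {x y h : A} (hxy : x * h = h * y)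
    (q : k[X]) : aeval x q * h = h * aeval y q := by
  induction q using Polynomial.induction_on' with
  | add a b ha hb => rw [map_add, map_add, add_mul, mul_add, ha, hb]
  | monomial m a =>
    rw [aeval_monomial, aeval_monomial, mul_assoc,
      ((show SemiconjBy h y x from hxy.symm).pow_right m).eq.symm, ← mul_assoc, ← mul_assoc,
      Algebra.commutes]

/-- Sylvester's theorem: matrices with disjoint spectra have no nonzero intertwiners. -/
theorem eq_zero_of_mul_eq_mul_of_disjoint [IsAlgClosed k] {x y h : Matrix n n k}
    (hd : ∀ μ, μ ∈ spectrum k y → μ ∉ spectrum k x) (hxy : x * h = h * y) : h = 0 := by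
  -- The characteristic polynomial of `y` kills `y` but is invertible at `x`, since none of its
  -- roots is an eigenvalue of `x`.
  have h1 := aeval_mul_eq_mul_aeval hxy y.charpoly
  rw [Matrix.aeval_self_charpoly, mul_zero] at h1
  have h2 : IsUnit (Polynomial.aeval x y.charpoly) := by
    by_contra hu
    have hs := (IsAlgClosed.splits y.charpoly).eq_prod_roots_of_monic y.charpoly_monic
    rw [hs] at hu
    obtain ⟨μ, hμ, hμ'⟩ := spectrum.exists_mem_of_not_isUnit_aeval_prod hu
    exact hd μ (Matrix.mem_spectrum_iff_isRoot_charpoly.2 hμ') hμ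
  exact h2.mul_right_eq_zero.1 h1

-- The factor for `a = 0` is split off because it is the only one that need not be injective when
-- evaluated at the Higgs commutator.
open Polynomial in
theorem X_pow_sub_X_eq_prod (p : ℕ) [Fact p.Prime] [Algebra (ZMod p) k] :
    (X ^ p - X : k[X]) =
      (∏ a ∈ Finset.univ.erase (0 : ZMod p), (X - C (algebraMap (ZMod p) k a))) * X := by
  have hcard : Fintype.card (ZMod p) = p := ZMod.card p
  have hp : 1 < p := (Fact.out : p.Prime).one_lt
  have h : (X ^ p - X : (ZMod p)[X]) = ∏ a : ZMod p, (X - C a) := by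
    have h1 := FiniteField.roots_X_pow_card_sub_X (ZMod p)
    have h2 := FiniteField.X_pow_card_sub_X_natDegree_eq (ZMod p) hp
    rw [hcard] at h1
    have hm : (X ^ p - X : (ZMod p)[X]).Monic :=
      monic_X_pow_sub (by rw [degree_X]; exact_mod_cast hp)
    have h3 := prod_multiset_X_sub_C_of_monic_of_roots_card_eq hm (by
      rw [h1, h2]; simp)
    rw [h1] at h3
    exact h3.symm
  have h' := congrArg (Polynomial.map (algebraMap (ZMod p) k)) h
  rw [← Finset.prod_erase_mul _ _ (Finset.mem_univ (0 : ZMod p))] at h'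
  simpa [Polynomial.map_prod] using h'

variable {p : ℕ} [Fact p.Prime] [Algebra (ZMod p) k] {r : k →ₗ[ZMod p] ZMod p}
  {G T : Subgroup (GL n k)} {τ : Matrix n n k}

/-- The eigenvalues `σ i` of the semisimple part satisfy `r (σ i) = 0`, so `s - μ` is invertible
when `r μ ≠ 0`, and adding the commuting nilpotent `ν` preserves invertibility. -/
theorem HasIrrationalSemisimplePart.eq_zero_of_mem_spectrum [Infinite k] (hT : IsTorus T)
    {a : Matrix n n k} (h : HasIrrationalSemisimplePart r G T τ a) {μ : k}
    (hμ : μ ∈ spectrum k a) : r μ = 0 := by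
  by_contra hr
  refine hμ ?_
  rw [spectrum.mem_resolventSet_iff, ← IsUnit.neg_iff, neg_sub]
  obtain ⟨P, hP⟩ := hT.diagonalizable
  obtain ⟨s, ν, ⟨rfl, hc, -, hν⟩, g, -, -, hs⟩ := h
  obtain ⟨σ, h1, h2⟩ := hs.exists_diagonal hP
  have h3 : ∀ i, r (σ i) = 0 := by
    intro i
    have := congrFun (congrFun h2 i) i
    simpa using this.symm
  have h4 : s - algebraMap k _ μ = ((P * g)⁻¹ : GL n k) * Matrix.diagonal (fun i => σ i - μ) *
      ((P * g : GL n k) : Matrix n n k) := by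
    have h5 : Matrix.diagonal (fun i => σ i - μ) =
        ((P * g : GL n k) : Matrix n n k) * (s - algebraMap k _ μ) *
          ((P * g)⁻¹ : GL n k) := by
      rw [mul_sub, sub_mul, ← Algebra.commutes, mul_assoc (algebraMap k (Matrix n n k) μ),
        (P * g).mul_inv, mul_one, ← Matrix.diagonal_sub]
      simp only [mul_inv_rev, Units.val_mul, mul_assoc] at h1 ⊢
      rw [h1]
      rfl
    rw [h5]
    simp only [mul_assoc, (P * g).inv_mul, mul_one]
    rw [← mul_assoc, (P * g).inv_mul, one_mul]
  have h5 : IsUnit (s - algebraMap k _ μ) := by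
    rw [h4]
    refine (Units.isUnit _).mul ?_ |>.mul (Units.isUnit _)
    rw [Matrix.isUnit_diagonal, Pi.isUnit_iff]
    intro i
    refine IsUnit.mk0 _ fun h0 => hr ?_
    rw [← sub_eq_zero.1 h0, h3]
  have h6 : s + ν - algebraMap k _ μ = s - algebraMap k _ μ + ν := by abel
  rw [h6]
  exact hν.isUnit_add_left_of_commute h5 (hc.symm.sub_right (Algebra.commutes μ ν).symm)

/-- Once the lower coefficients vanish, `u_i` intertwines `ψ_0` with `φ_0 + a`. These have disjoint
spectra: `r` is zero on the first and equal to `a ≠ 0` on the second, so Sylvester's theorem applies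
degree by degree. -/
theorem eq_zero_of_intertwine [IsAlgClosed k] (hr : r 1 = 1) {φ ψ : Matrix n n k⟦X⟧}
    (hφ : ∀ μ ∈ spectrum k (coeffMat 0 φ), r μ = 0) (hψ : ∀ μ ∈ spectrum k (coeffMat 0 ψ), r μ = 0)
    {a : ZMod p} (ha : a ≠ 0) {u : Matrix n n k⟦X⟧}
    (hu : ψ * u - u * φ = constMat (algebraMap k (Matrix n n k) (algebraMap (ZMod p) k a)) * u) :
    u = 0 := by
  have hra : r (algebraMap (ZMod p) k a) = a := by
    rw [Algebra.algebraMap_eq_smul_one, map_smul, hr, smul_eq_mul, mul_one]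
  have h0 : ∀ i, coeffMat i u = 0 := by
    intro i
    induction i using Nat.strong_induction_on with
    | _ i ih =>
    have h1 := congrArg (coeffMat i) hu
    rw [coeffMat_sub, coeffMat_constMat_mul, coeffMat_mul, coeffMat_mul,
      Finset.sum_eq_single (0, i), Finset.sum_eq_single (i, 0)] at h1
    · refine eq_zero_of_mul_eq_mul_of_disjoint (x := coeffMat 0 ψ)
        (y := coeffMat 0 φ + algebraMap k _ (algebraMap (ZMod p) k a)) (fun μ h2 h3 => ha ?_) ?_
      · have h4 : μ - algebraMap (ZMod p) k a ∈ spectrum k (coeffMat 0 φ) := by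
          rw [spectrum.mem_iff] at h2 ⊢
          rwa [map_sub, sub_sub, add_comm (algebraMap _ _ _)]
        have h5 := hφ _ h4
        rw [map_sub, hψ _ h3, hra, zero_sub, neg_eq_zero] at h5
        exact h5
      · rw [mul_add, ← Algebra.commutes, ← h1]
        abel
    · rintro ⟨b, c⟩ hbc hne
      rw [Finset.HasAntidiagonal.mem_antidiagonal] at hbc
      have : b < i := by
        rcases Nat.eq_zero_or_pos c with rfl | hc
        · exact absurd (by simpa using hbc) (fun h : b = i => hne (by rw [h]))
        · simp only at hbc; omega
      simp only [ih b this, zero_mul]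
    · simp
    · rintro ⟨b, c⟩ hbc hne
      rw [Finset.HasAntidiagonal.mem_antidiagonal] at hbc
      have : c < i := by
        rcases Nat.eq_zero_or_pos b with rfl | hc
        · exact absurd (by simpa using hbc) (fun h : c = i => hne (by rw [h]))
        · simp only at hbc; omega
      simp only [ih c this, mul_zero]
    · simp
  exact coeffMat_ext fun i => (h0 i).trans (by ext; simp [coeffMat])

/-- The operator `u ↦ z du/dz + u τ - τ u`. -/
noncomputable def rationalConn (τ : Matrix n n k) : Module.End k (Matrix n n k⟦X⟧) where
  toFun u := eulerMat u + u * constMat τ - constMat τ * u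
  map_add' u v := by
    have : eulerMat (u + v) = eulerMat u + eulerMat v := by ext; simp [eulerMat, mul_add]
    rw [this, add_mul, mul_add]; abel
  map_smul' c u := by
    have : eulerMat (c • u) = c • eulerMat u := by ext; simp [eulerMat]
    rw [this, RingHom.id_apply, smul_sub, smul_add, smul_mul_assoc, mul_smul_comm]

theorem rationalConn_apply (u : Matrix n n k⟦X⟧) :
    rationalConn τ u = eulerMat u + u * constMat τ - constMat τ * u := rfl

theorem rationalConn_mul (u v : Matrix n n k⟦X⟧) :
    rationalConn τ (u * v) = rationalConn τ u * v + u * rationalConn τ v := by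
  simp only [rationalConn_apply, eulerMat_mul, add_mul, sub_mul, mul_add, mul_sub, mul_assoc]
  abel

/-- In a basis diagonalizing `τ` the operator multiplies the `(a, b)` entry of the coefficient of `z
^ i` by `i + d b - d a`, an element of the prime field, which the `p`-th power map fixes. -/
theorem rationalConn_pow (hτ : ∃ (Q : GL n k) (d : n → ℤ),
      (Q : Matrix n n k) * τ * ((Q⁻¹ : GL n k) : Matrix n n k) =
        Matrix.diagonal fun i => (d i : k)) (u : Matrix n n k⟦X⟧) :
    (rationalConn τ ^ p) u = rationalConn τ u := by
  obtain ⟨Q, d, hd⟩ := hτ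
  let conj : Matrix n n k → Matrix n n k := fun x =>
    (Q : Matrix n n k) * x * ((Q⁻¹ : GL n k) : Matrix n n k)
  have hinj : Function.Injective conj := by
    intro x y h
    have h1 := congrArg (fun z => ((Q⁻¹ : GL n k) : Matrix n n k) * z * (Q : Matrix n n k)) h
    simp only [conj, mul_assoc, Q.inv_mul, mul_one] at h1
    simpa only [← mul_assoc, Q.inv_mul, one_mul] using h1
  have hmul : ∀ x y, conj (x * y) = conj x * conj y := by
    intro x y
    simp only [conj, mul_assoc]
    rw [← mul_assoc ((Q⁻¹ : GL n k) : Matrix n n k) (Q : Matrix n n k), Q.inv_mul, one_mul]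
  have hstep : ∀ (i : ℕ) (v : Matrix n n k⟦X⟧) (a b : n),
      conj (coeffMat i (rationalConn τ v)) a b =
        ((i + d b - d a : ℤ) : k) * conj (coeffMat i v) a b := by
    intro i v a b
    have h1 : conj (coeffMat i (rationalConn τ v)) =
        (i : k) • conj (coeffMat i v) + conj (coeffMat i v) * conj τ -
          conj τ * conj (coeffMat i v) := by
      rw [rationalConn_apply, coeffMat_sub, coeffMat_add, coeffMat_eulerMat,
        coeffMat_constMat_mul, coeffMat_mul_constMat, ← hmul, ← hmul]
      simp only [conj, mul_add, add_mul, mul_sub, sub_mul, mul_smul_comm, smul_mul_assoc]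
    have h2 : conj τ = Matrix.diagonal fun i => (d i : k) := hd
    rw [h1, h2, Matrix.sub_apply, Matrix.add_apply, Matrix.mul_diagonal, Matrix.diagonal_mul,
      Matrix.smul_apply, smul_eq_mul]
    push_cast
    ring
  have hpow : ∀ (m i : ℕ) (a b : n), conj (coeffMat i ((rationalConn τ ^ m) u)) a b =
      ((i + d b - d a : ℤ) : k) ^ m * conj (coeffMat i u) a b := by
    intro m i a b
    induction m with
    | zero => simp
    | succ m ih => rw [pow_succ', Module.End.mul_apply, hstep, ih, pow_succ']; ring
  refine coeffMat_ext fun i => hinj (Matrix.ext fun a b => ?_)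
  rw [hpow, hstep]
  congr 1
  rw [← map_intCast (algebraMap (ZMod p) k), ← map_pow, ZMod.pow_card]

/-- A horizontal section of `Hom` between two tame connections with the same rational part and with
irrational remainders `φ`, `ψ` is horizontal for the rational parts. -/
theorem rationalConn_eq_zero [IsAlgClosed k] (hr : r 1 = 1)
    (hτ : ∃ (Q : GL n k) (d : n → ℤ),
      (Q : Matrix n n k) * τ * ((Q⁻¹ : GL n k) : Matrix n n k) =
        Matrix.diagonal fun i => (d i : k)) {φ ψ u : Matrix n n k⟦X⟧}
    (hφ : ∀ μ ∈ spectrum k (coeffMat 0 φ), r μ = 0) (hψ : ∀ μ ∈ spectrum k (coeffMat 0 ψ), r μ = 0)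
    (hφτ : rationalConn τ φ = 0) (hψτ : rationalConn τ ψ = 0)
    (hu : rationalConn τ u = ψ * u - u * φ) : rationalConn τ u = 0 := by
  let K : Module.End k (Matrix n n k⟦X⟧) :=
    { toFun := fun v => ψ * v - v * φ
      map_add' := fun v w => by rw [mul_add, add_mul]; abel
      map_smul' := fun c v => by
        rw [RingHom.id_apply, smul_sub, mul_smul_comm, smul_mul_assoc] }
  have hK : ∀ v, K v = ψ * v - v * φ := fun _ => rfl
  have hcomm : Commute (rationalConn τ) K := by
    refine LinearMap.ext fun v => ?_
    rw [Module.End.mul_apply, Module.End.mul_apply, hK, hK, map_sub, rationalConn_mul,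
      rationalConn_mul, hφτ, hψτ, zero_mul, mul_zero, zero_add, add_zero]
  have hpow : ∀ m : ℕ, (rationalConn τ ^ m) u = (K ^ m) u := by
    intro m
    induction m with
    | zero => rfl
    | succ m ih =>
      rw [pow_succ, Module.End.mul_apply, hu, ← hK, ← Module.End.mul_apply,
        (hcomm.pow_left m).eq, Module.End.mul_apply, ih, pow_succ', Module.End.mul_apply]
  -- On `u` the powers of the two commuting operators agree, so the identity for `rationalConn τ`
  -- passes to `K`.
  have h1 : (K ^ p) u = K u := by rw [← hpow, rationalConn_pow hτ, hu, hK]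
  have h2 : Polynomial.aeval K (∏ a ∈ Finset.univ.erase (0 : ZMod p),
      (Polynomial.X - Polynomial.C (algebraMap (ZMod p) k a))) (K u) = 0 := by
    have h3 := congrArg (fun q => Polynomial.aeval K q u) (X_pow_sub_X_eq_prod (k := k) p)
    simp only [map_sub, map_pow, map_mul, Polynomial.aeval_X, LinearMap.sub_apply, h1, sub_self,
      Module.End.mul_apply] at h3
    exact h3.symm
  have h3 : Function.Injective (Polynomial.aeval K (∏ a ∈ Finset.univ.erase (0 : ZMod p),
      (Polynomial.X - Polynomial.C (algebraMap (ZMod p) k a)))) := by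
    refine Finset.prod_induction _ (fun q => Function.Injective (Polynomial.aeval K q))
      (fun q q' hq hq' => ?_) ?_ fun a ha => ?_
    · rw [map_mul]; exact hq.comp hq'
    · rw [map_one]; exact Function.injective_id
    · rw [injective_iff_map_eq_zero]
      intro v hv
      refine eq_zero_of_intertwine hr hφ hψ (Finset.ne_of_mem_erase ha) ?_
      rw [map_sub, Polynomial.aeval_X, Polynomial.aeval_C, LinearMap.sub_apply, hK,
        sub_eq_zero, Module.algebraMap_end_apply] at hv
      rw [hv]
      ext i j : 2
      simp [constMat, Matrix.mul_apply, Matrix.algebraMap_matrix_apply, apply_ite,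
        Algebra.smul_def]
  rw [hu, ← hK]
  exact h3 (h2.trans (map_zero _).symm)

end Fullness

/-! ### Reduction to standard form -/

section StandardForm

set_option linter.unusedSectionVars false

variable {k : Type*} [Field k] {n : Type*} [Fintype n] [DecidableEq n]

/-- Congruence of matrices over `k⟦z⟧` modulo `z ^ i`. -/
def CongrMod (i : ℕ) (A B : Matrix n n k⟦X⟧) : Prop := ∀ j < i, coeffMat j A = coeffMat j B

namespace CongrMod

variable {i : ℕ} {A B A' B' : Matrix n n k⟦X⟧}

theorem refl (A : Matrix n n k⟦X⟧) : CongrMod i A A := fun _ _ => rfl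

theorem symm (h : CongrMod i A B) : CongrMod i B A := fun j hj => (h j hj).symm

theorem trans (h : CongrMod i A B) (h' : CongrMod i B B') : CongrMod i A B' :=
  fun j hj => (h j hj).trans (h' j hj)

theorem mono {j : ℕ} (hji : j ≤ i) (h : CongrMod i A B) : CongrMod j A B :=
  fun l hl => h l (hl.trans_le hji)

theorem add (h : CongrMod i A B) (h' : CongrMod i A' B') : CongrMod i (A + A') (B + B') := by
  intro j hj
  rw [coeffMat_add, coeffMat_add, h j hj, h' j hj]

theorem mul (h : CongrMod i A B) (h' : CongrMod i A' B') : CongrMod i (A * A') (B * B') := by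
  intro j hj
  rw [coeffMat_mul, coeffMat_mul]
  refine Finset.sum_congr rfl fun ab hab => ?_
  have := Finset.HasAntidiagonal.mem_antidiagonal.1 hab
  rw [h ab.1 (by omega), h' ab.2 (by omega)]

theorem eulerMat (h : CongrMod i A B) : CongrMod i (eulerMat A) (eulerMat B) := by
  intro j hj
  rw [coeffMat_eulerMat, coeffMat_eulerMat, h j hj]

theorem inv {g h : GL n k⟦X⟧} (hgh : CongrMod i (g : Matrix n n k⟦X⟧) h) :
    CongrMod i ((g⁻¹ : GL n k⟦X⟧) : Matrix n n k⟦X⟧) ((h⁻¹ : GL n k⟦X⟧) : Matrix n n k⟦X⟧) := by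
  have h1 := ((refl ((g⁻¹ : GL n k⟦X⟧) : Matrix n n k⟦X⟧)).mul hgh).mul
    (refl (i := i) ((h⁻¹ : GL n k⟦X⟧) : Matrix n n k⟦X⟧))
  rw [g.inv_mul, one_mul, mul_assoc, h.mul_inv, mul_one] at h1
  exact h1.symm

theorem gaugeAct {g h : GL n k⟦X⟧} (hgh : CongrMod i (g : Matrix n n k⟦X⟧) h)
    (hA : CongrMod i A B) : CongrMod i (gaugeAct g A) (gaugeAct h B) :=
  (hgh.eulerMat.mul hgh.inv).add ((hgh.mul hA).mul hgh.inv)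

/-- Polynomial evaluation commutes with reduction modulo `z ^ i`; this is what makes `G(𝒪)` closed
under `z`-adic limits. -/
theorem evalMat_coeff (h : CongrMod i A B) (f : MvPolynomial (n × n) k) {j : ℕ} (hj : j < i) :
    PowerSeries.coeff j (evalMat f A) = PowerSeries.coeff j (evalMat f B) := by
  let q := Ideal.Quotient.mkₐ k (Ideal.span {(PowerSeries.X : k⟦X⟧) ^ i})
  have hq : ∀ a b : k⟦X⟧, q a = q b ↔ ∀ j < i, PowerSeries.coeff j a = PowerSeries.coeff j b := by
    intro a b
    simp only [q, Ideal.Quotient.mkₐ_eq_mk, Ideal.Quotient.eq, Ideal.mem_span_singleton,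
      PowerSeries.X_pow_dvd_iff, map_sub, sub_eq_zero]
  refine (hq _ _).1 ?_ j hj
  rw [← evalMat_map_algHom, ← evalMat_map_algHom]
  congr 1
  ext a b
  exact (hq _ _).2 fun j hj => congrFun (congrFun (h j hj) a) b

end CongrMod

theorem gaugeAct_mul_self (g : GL n k⟦X⟧) (A : Matrix n n k⟦X⟧) :
    gaugeAct g A * (g : Matrix n n k⟦X⟧) = eulerMat (g : Matrix n n k⟦X⟧) + g * A := by
  rw [gaugeAct, adj, add_mul, mul_assoc, g.inv_mul, mul_one, mul_assoc (_ * _), g.inv_mul, mul_one]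

/-- Substitute `z ^ (i + 1)` for `z` in an arc with velocity `x`. This replaces the exponential of
`x z ^ (i + 1)`. -/
theorem exists_arc_pow [PerfectField k] {G : Subgroup (GL n k)} {x : Matrix n n k}
    (hx : x ∈ lieAlg G) (i : ℕ) :
    ∃ g ∈ points k⟦X⟧ G, CongrMod (i + 1) (g : Matrix n n k⟦X⟧) 1 ∧
      coeffMat (i + 1) (g : Matrix n n k⟦X⟧) = x := by
  obtain ⟨γ, hγ, h0, h1⟩ := exists_arc hx
  refine ⟨_, map_mem_points (PowerSeries.expand (i + 1) i.succ_ne_zero) hγ, ?_, ?_⟩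
  · intro j hj
    ext a b
    rcases Nat.eq_zero_or_pos j with rfl | hj0
    · have := congrFun (congrFun h0 a) b
      rw [coeffMat_one, if_pos rfl, ← this]
      exact (PowerSeries.coeff_expand (i + 1) i.succ_ne_zero _).trans (by simp [coeffMat])
    · rw [coeffMat_one, if_neg hj0.ne']
      refine (PowerSeries.coeff_expand (i + 1) i.succ_ne_zero _).trans ?_
      rw [if_neg (Nat.not_dvd_of_pos_of_lt hj0 hj)]
      rfl
  · ext a b
    have := congrFun (congrFun h1 a) b
    rw [← this]
    exact (PowerSeries.coeff_expand (i + 1) i.succ_ne_zero _).trans (by simp [coeffMat])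

/-- Compare coefficients of `z ^ (i + 1)` in `B g = z g' + g A`, where `B` is the transformed
connection: the intermediate coefficients of `g` vanish, so only the end terms of each convolution
survive. -/
theorem coeffMat_gaugeAct {g : GL n k⟦X⟧} {i : ℕ}
    (hg : CongrMod (i + 1) (g : Matrix n n k⟦X⟧) 1) (A : Matrix n n k⟦X⟧) :
    coeffMat (i + 1) (gaugeAct g A) = coeffMat (i + 1) A -
      (adLie (coeffMat 0 A) - ((i + 1 : ℕ) : k) • 1) (coeffMat (i + 1) (g : Matrix n n k⟦X⟧)) := by
  have hends : ∀ C D : ℕ → Matrix n n k, (∀ j, 0 < j → j < i + 1 → C j * D (i + 1 - j) = 0) →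
      ∑ ab ∈ Finset.HasAntidiagonal.antidiagonal (i + 1), C ab.1 * D ab.2 =
        C 0 * D (i + 1) + C (i + 1) * D 0 := by
    intro C D h
    rw [Finset.Nat.sum_antidiagonal_eq_sum_range_succ (fun a b => C a * D b),
      Finset.sum_range_succ, Finset.sum_range_succ']
    rw [Finset.sum_eq_zero fun j hj => h (j + 1) j.succ_pos (by simpa using hj)]
    simp
  have hmid : ∀ j, 0 < j → j < i + 1 → coeffMat j (g : Matrix n n k⟦X⟧) = 0 := by
    intro j hj hj'
    rw [hg j hj', coeffMat_one, if_neg hj.ne']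
  have hg0 : coeffMat 0 (g : Matrix n n k⟦X⟧) = 1 := by
    rw [hg 0 i.succ_pos, coeffMat_one, if_pos rfl]
  have hB0 : coeffMat 0 (gaugeAct g A) = coeffMat 0 A := by
    have h1 : CongrMod (i + 1) (gaugeAct g A) (gaugeAct 1 A) :=
      CongrMod.gaugeAct hg (CongrMod.refl A)
    rw [h1 0 i.succ_pos, gaugeAct_one]
  have h := congrArg (coeffMat (i + 1)) (gaugeAct_mul_self g A)
  rw [coeffMat_mul, coeffMat_add, coeffMat_mul, coeffMat_eulerMat,
    hends (fun j => coeffMat j (gaugeAct g A)) (fun j => coeffMat j (g : Matrix n n k⟦X⟧))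
      (fun j hj hj' => by rw [hmid (i + 1 - j) (by omega) (by omega), mul_zero]),
    hends (fun j => coeffMat j (g : Matrix n n k⟦X⟧)) (fun j => coeffMat j A)
      (fun j hj hj' => by rw [hmid j hj hj', zero_mul]), hg0, hB0, mul_one, one_mul] at h
  rw [LinearMap.sub_apply, adLie_apply, LinearMap.smul_apply, Module.End.one_apply,
    eq_sub_of_add_eq' h]
  abel

/-- Fitting decomposition of the restriction of an endomorphism to an invariant subspace. -/
theorem exists_sub_mem_maxGenEigenspace {V : Type*} [AddCommGroup V] [Module k V]
    [FiniteDimensional k V] (f : Module.End k V) (μ : k) (W : Submodule k V)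
    (hW : ∀ x ∈ W, f x ∈ W) {y : V} (hy : y ∈ W) :
    ∃ x ∈ W, y - (f - μ • 1) x ∈ f.maxGenEigenspace μ := by
  have hW' : ∀ x ∈ W, (f - μ • (1 : Module.End k V)) x ∈ W := fun x hx =>
    sub_mem (hW x hx) (W.smul_mem _ hx)
  let e : Module.End k W := (f - μ • (1 : Module.End k V)).restrict hW'
  obtain ⟨m, hm⟩ := (LinearMap.eventually_isCompl_ker_pow_range_pow e).exists_forall_of_atTop
  -- Exponent `m + 1` rather than `m` makes it positive, so the component in the range can be
  -- written as `e` applied to `e ^ m c`.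
  have hc := hm (m + 1) m.le_succ
  obtain ⟨a, ha, b, hb, hab⟩ := Submodule.mem_sup.1
    (hc.sup_eq_top ▸ Submodule.mem_top : (⟨y, hy⟩ : W) ∈
      LinearMap.ker (e ^ (m + 1)) ⊔ LinearMap.range (e ^ (m + 1)))
  obtain ⟨c, rfl⟩ := hb
  refine ⟨(e ^ m) c, ((e ^ m) c).2, ?_⟩
  have h1 : (a : V) = y - (f - μ • (1 : Module.End k V)) ((e ^ m) c) := by
    have h2 := congrArg Subtype.val hab
    rw [pow_succ', Module.End.mul_apply] at h2
    exact eq_sub_of_add_eq h2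
  rw [← h1, Module.End.mem_maxGenEigenspace]
  refine ⟨m + 1, ?_⟩
  have h3 := congrArg Subtype.val (LinearMap.mem_ker.1 ha)
  rw [Module.End.pow_restrict] at h3
  exact h3

theorem exists_gauge_step [PerfectField k] {G : Subgroup (GL n k)} {A : Matrix n n k⟦X⟧}
    (hA : A ∈ loopAlg G) (i : ℕ) :
    ∃ g ∈ points k⟦X⟧ G, CongrMod (i + 1) (g : Matrix n n k⟦X⟧) 1 ∧
      coeffMat (i + 1) (gaugeAct g A) ∈
        Module.End.maxGenEigenspace (adLie (coeffMat 0 A)) ((i + 1 : ℕ) : k) := by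
  obtain ⟨x, hx, hx'⟩ := exists_sub_mem_maxGenEigenspace (adLie (coeffMat 0 A)) ((i + 1 : ℕ) : k)
    (lieAlg G) (fun x hx => adLie_mem_lieAlg (hA 0) hx) (hA (i + 1))
  obtain ⟨g, hg, h1, h2⟩ := exists_arc_pow hx i
  refine ⟨g, hg, h1, ?_⟩
  rwa [coeffMat_gaugeAct h1, h2]

/-- The coefficient of `z ^ i` is constant from `P i` onwards, so the limit can be read off the
diagonal; its equations hold coefficient by coefficient. -/
theorem exists_limit {G : Subgroup (GL n k)} (P : ℕ → GL n k⟦X⟧)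
    (hP : ∀ i, P i ∈ points k⟦X⟧ G)
    (hc : ∀ i, CongrMod (i + 1) (P (i + 1) : Matrix n n k⟦X⟧) (P i)) :
    ∃ L ∈ points k⟦X⟧ G, ∀ i, CongrMod (i + 1) (L : Matrix n n k⟦X⟧) (P i) := by
  have hc' : ∀ i j, i ≤ j → CongrMod (i + 1) (P j : Matrix n n k⟦X⟧) (P i) := by
    intro i j hij
    induction j, hij using Nat.le_induction with
    | base => exact CongrMod.refl _
    | succ j hij ih => exact ((hc j).mono (by omega)).trans ih
  let M : Matrix n n k⟦X⟧ := Matrix.of fun a b =>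
    PowerSeries.mk fun i => PowerSeries.coeff i ((P i : Matrix n n k⟦X⟧) a b)
  have hM : ∀ i, CongrMod (i + 1) M (P i) := by
    intro i j hj
    rw [hc' j i (by omega) j (by omega)]
    ext a b
    simp [M, coeffMat]
  have hu : IsUnit M := by
    refine isUnit_of_coeffMat_zero ?_
    rw [hM 0 0 zero_lt_one]
    refine IsUnit.of_mul_eq_one (coeffMat 0 (((P 0)⁻¹ : GL n k⟦X⟧) : Matrix n n k⟦X⟧)) ?_
    rw [← coeffMat_mul_zero, (P 0).mul_inv, coeffMat_one, if_pos rfl]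
  obtain ⟨L, hL⟩ := hu
  refine ⟨L, fun f hf => ?_, fun i => hL ▸ hM i⟩
  ext i
  rw [hL, (hM i).evalMat_coeff f i.lt_succ_self, hP i f hf]

/-- Every tame connection is gauge equivalent to one in standard form with the same residue. -/
theorem exists_standardForm [PerfectField k] {G : Subgroup (GL n k)} {A : Matrix n n k⟦X⟧}
    (hA : A ∈ loopAlg G) :
    ∃ g ∈ points k⟦X⟧ G, coeffMat 0 (gaugeAct g A) = coeffMat 0 A ∧
      IsStandardForm (gaugeAct g A) := by
  -- The correction in degree `i + 1` is congruent to `1` modulo `z ^ (i + 1)`, so it disturbs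
  -- neither the residue nor the coefficients already corrected, and the products converge.
  have hstep : ∀ (h : points k⟦X⟧ G) (i : ℕ), ∃ h' : points k⟦X⟧ G,
      CongrMod (i + 1) ((h' : GL n k⟦X⟧) : Matrix n n k⟦X⟧) (h : GL n k⟦X⟧) ∧
      coeffMat (i + 1) (gaugeAct (h' : GL n k⟦X⟧) A) ∈ Module.End.maxGenEigenspace
        (adLie (coeffMat 0 (gaugeAct (h : GL n k⟦X⟧) A))) ((i + 1 : ℕ) : k) := by
    intro h i
    obtain ⟨g, hg, h1, h2⟩ := exists_gauge_step (gaugeAct_mem_loopAlg h.2 hA) i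
    refine ⟨⟨g * h, mul_mem hg h.2⟩, ?_, ?_⟩
    · have h3 := h1.mul (CongrMod.refl ((h : GL n k⟦X⟧) : Matrix n n k⟦X⟧))
      rwa [one_mul] at h3
    · rwa [gaugeAct_mul]
  choose step hcong hmem using hstep
  obtain ⟨P, hP0, hP⟩ : ∃ P : ℕ → points k⟦X⟧ G, P 0 = 1 ∧ ∀ i, P (i + 1) = step (P i) i :=
    ⟨fun i => Nat.rec 1 (fun i h => step h i) i, rfl, fun _ => rfl⟩
  have hc : ∀ i, CongrMod (i + 1) ((P (i + 1) : GL n k⟦X⟧) : Matrix n n k⟦X⟧)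
      ((P i : GL n k⟦X⟧) : Matrix n n k⟦X⟧) := fun i => by rw [hP]; exact hcong (P i) i
  obtain ⟨L, hL, hLP⟩ := exists_limit (fun i => (P i : GL n k⟦X⟧)) (fun i => (P i).2) hc
  have hLA : ∀ i, CongrMod (i + 1) (gaugeAct L A) (gaugeAct (P i : GL n k⟦X⟧) A) :=
    fun i => (hLP i).gaugeAct (CongrMod.refl A)
  have h0 : coeffMat 0 (gaugeAct L A) = coeffMat 0 A := by
    rw [hLA 0 0 zero_lt_one, hP0, OneMemClass.coe_one, gaugeAct_one]
  refine ⟨L, hL, h0, fun i => ?_⟩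
  rw [h0]
  cases i with
  | zero =>
    rw [h0, Module.End.mem_maxGenEigenspace]
    exact ⟨1, by simp [adLie_apply]⟩
  | succ i =>
    rw [hLA (i + 1) (i + 1) (Nat.lt_succ_self _), hP, ← h0, hLA i 0 i.succ_pos]
    exact hmem (P i) i

end StandardForm

/-! ### Rational parts, normalized connections, and the equivalence -/

section Equivalence

set_option linter.unusedSectionVars false

variable {k : Type*} [Field k] {n : Type*} [Fintype n] [DecidableEq n]

theorem mul_eq_mul_diagonal {Q : GL n k} {s : Matrix n n k} {σ : n → k}
    (h : (Q : Matrix n n k) * s * ((Q⁻¹ : GL n k) : Matrix n n k) = Matrix.diagonal σ) :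
    s * ((Q⁻¹ : GL n k) : Matrix n n k) = ((Q⁻¹ : GL n k) : Matrix n n k) * Matrix.diagonal σ := by
  rw [← h, mul_assoc, ← mul_assoc, Q.inv_mul, one_mul]

theorem eq_of_conj_eq {Q : GL n k} {x y : Matrix n n k}
    (h : (Q : Matrix n n k) * x * ((Q⁻¹ : GL n k) : Matrix n n k) =
      (Q : Matrix n n k) * y * ((Q⁻¹ : GL n k) : Matrix n n k)) : x = y := by
  have h1 := congrArg (fun z => ((Q⁻¹ : GL n k) : Matrix n n k) * z * (Q : Matrix n n k)) h
  simp only [mul_assoc, Q.inv_mul, mul_one] at h1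
  simpa only [← mul_assoc, Q.inv_mul, one_mul] using h1

theorem conj_mul_conj (Q : GL n k) (x y : Matrix n n k) :
    (Q : Matrix n n k) * (x * y) * ((Q⁻¹ : GL n k) : Matrix n n k) =
      (Q : Matrix n n k) * x * ((Q⁻¹ : GL n k) : Matrix n n k) *
        ((Q : Matrix n n k) * y * ((Q⁻¹ : GL n k) : Matrix n n k)) := by
  simp only [mul_assoc]
  rw [← mul_assoc ((Q⁻¹ : GL n k) : Matrix n n k) (Q : Matrix n n k), Q.inv_mul, one_mul]

-- The product of `X - c` over the distinct diagonal entries is squarefree and annihilates `s`.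
open Polynomial in
theorem isSemisimple_toLin'_of_conj_diagonal {Q : GL n k} {s : Matrix n n k} {σ : n → k}
    (h : (Q : Matrix n n k) * s * ((Q⁻¹ : GL n k) : Matrix n n k) = Matrix.diagonal σ) :
    Module.End.IsSemisimple (Matrix.toLin' s) := by
  classical
  let q : k[X] := ∏ c ∈ Finset.univ.image σ, (X - C c)
  have hq : Squarefree q :=
    (separable_prod_X_sub_C_iff'.2 fun x _ y _ hxy => hxy).squarefree
  refine Module.End.isSemisimple_of_squarefree_aeval_eq_zero hq ?_
  have h1 : aeval s q = 0 := by
    have h2 : aeval (Matrix.diagonal σ) q = 0 := by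
      have h3 := aeval_algHom_apply (Matrix.diagonalAlgHom k) σ q
      refine h3.trans ?_
      have h4 : aeval σ q = 0 := by
        ext i
        have h5 := aeval_algHom_apply (Pi.evalAlgHom k (fun _ : n => k) i) σ q
        refine h5.symm.trans ?_
        simp only [q, map_prod]
        refine Finset.prod_eq_zero (Finset.mem_image_of_mem σ (Finset.mem_univ i)) ?_
        simp
      rw [h4, map_zero]
    have h3 := aeval_mul_eq_mul_aeval (mul_eq_mul_diagonal h) q
    rw [h2, mul_zero] at h3
    exact (Q⁻¹).isUnit.mul_left_eq_zero.1 h3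
  have h2 := aeval_algHom_apply (Matrix.toLinAlgEquiv' (R := k) (n := n)).toAlgHom s q
  rw [h1, map_zero] at h2
  exact h2

theorem commute_of_conj_diagonal {Q : GL n k} {s τ : Matrix n n k} {σ d : n → k}
    (h : (Q : Matrix n n k) * s * ((Q⁻¹ : GL n k) : Matrix n n k) = Matrix.diagonal σ)
    (h' : (Q : Matrix n n k) * τ * ((Q⁻¹ : GL n k) : Matrix n n k) = Matrix.diagonal d) :
    Commute s τ := by
  refine eq_of_conj_eq (Q := Q) ?_
  rw [conj_mul_conj, conj_mul_conj, h, h', Matrix.diagonal_mul_diagonal,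
    Matrix.diagonal_mul_diagonal]
  simp only [mul_comm]

theorem isNilpotent_adLie {ν : Matrix n n k} (h : IsNilpotent ν) : IsNilpotent (adLie ν) := by
  have h1 : IsNilpotent (LinearMap.mulLeft k ν) := by
    obtain ⟨m, hm⟩ := h
    exact ⟨m, by rw [LinearMap.pow_mulLeft, hm, LinearMap.mulLeft_zero_eq_zero]⟩
  have h2 : IsNilpotent (LinearMap.mulRight k ν) := by
    obtain ⟨m, hm⟩ := h
    exact ⟨m, by rw [LinearMap.pow_mulRight, hm, LinearMap.mulRight_zero_eq_zero]⟩
  exact (LinearMap.commute_mulLeft_right ν ν).isNilpotent_sub h1 h2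

/-- In the binomial expansion of `(f - g) ^ (m + l)` every term contains `f ^ m` or the vanishing
power `g ^ l`. It serves to replace `[a, -]` by `[s, -]` on generalized eigenspaces. -/
theorem exists_pow_sub_apply_eq_zero {V : Type*} [AddCommGroup V] [Module k V]
    {f g : Module.End k V} (hfg : Commute f g) (hg : IsNilpotent g) {v : V} {m : ℕ}
    (hv : (f ^ m) v = 0) : ∃ N, ((f - g) ^ N) v = 0 := by
  obtain ⟨l, hl⟩ := hg.neg
  refine ⟨m + l, ?_⟩
  rw [sub_eq_add_neg, hfg.neg_right.add_pow', LinearMap.sum_apply]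
  refine Finset.sum_eq_zero fun ij hij => ?_
  rw [Finset.HasAntidiagonal.mem_antidiagonal] at hij
  rw [LinearMap.smul_apply]
  rcases le_total m ij.1 with h | h
  · rw [((hfg.neg_right).pow_pow _ _).eq, Module.End.mul_apply, ← Nat.sub_add_cancel h, pow_add,
      Module.End.mul_apply, hv, map_zero, map_zero, smul_zero]
  · rw [← Nat.sub_add_cancel (show l ≤ ij.2 by omega), pow_add, hl, mul_zero, mul_zero,
      LinearMap.zero_apply, smul_zero]

theorem adLie_sub (a b : Matrix n n k) : adLie (a - b) = adLie a - adLie b := by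
  ext1 x; simp only [adLie_apply, LinearMap.sub_apply, sub_mul, mul_sub]; abel

theorem commute_adLie {a b : Matrix n n k} (h : Commute a b) : Commute (adLie a) (adLie b) := by
  refine LinearMap.ext fun x => ?_
  have h' := h.eq
  simp only [Module.End.mul_apply, adLie_apply, mul_sub, sub_mul, ← mul_assoc, h']
  simp only [mul_assoc, h']
  abel

variable {p : ℕ} [Fact p.Prime] [Algebra (ZMod p) k] {r : k →ₗ[ZMod p] ZMod p}
  {G T : Subgroup (GL n k)} {τ : Matrix n n k}

/-- In a basis diagonalizing `s`, a nonzero entry of `y` at `(a, b)` forces `σ a - σ b = i`.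
Applying `r`, which fixes the prime field, gives the same difference for the eigenvalues of `τ`; so
the generalized eigenvalue condition becomes a genuine one for `τ`. -/
theorem HasRationalPart.adLie_eq_smul [Infinite k] (hr : r 1 = 1) (hT : IsTorus T)
    {a y : Matrix n n k} (h : HasRationalPart r G T a τ) {i : ℕ}
    (hy : y ∈ Module.End.maxGenEigenspace (adLie a) (i : k)) :
    adLie τ y = (i : k) • y := by
  obtain ⟨P, hP⟩ := hT.diagonalizable
  obtain ⟨s, ν, ⟨rfl, hc, -, hν⟩, g, -, hs⟩ := h
  obtain ⟨σ, h1, h2⟩ := hs.exists_diagonal hP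
  obtain ⟨m, hm⟩ := (Module.End.mem_maxGenEigenspace _ _ _).1 hy
  have hcomm : Commute (adLie (s + ν) - (i : k) • 1) (adLie ν) :=
    (commute_adLie (hc.add_left (Commute.refl ν))).sub_left ((Commute.one_left _).smul_left _)
  obtain ⟨N, hN⟩ := exists_pow_sub_apply_eq_zero hcomm (isNilpotent_adLie hν) hm
  have hs' : adLie (s + ν) - (i : k) • 1 - adLie ν = adLie s - (i : k) • 1 := by
    rw [sub_right_comm, ← adLie_sub, add_sub_cancel_right]
  rw [hs'] at hN
  set Q := P * g
  have hQs : (Q : Matrix n n k) * s * ((Q⁻¹ : GL n k) : Matrix n n k) = Matrix.diagonal σ := by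
    rw [← h1]; simp only [Q, mul_inv_rev, Units.val_mul, mul_assoc]
  have hQτ : (Q : Matrix n n k) * τ * ((Q⁻¹ : GL n k) : Matrix n n k) =
      Matrix.diagonal fun i => algebraMap (ZMod p) k (r (σ i)) := by
    rw [← h2]; simp only [Q, mul_inv_rev, Units.val_mul, mul_assoc]
  have hentry : ∀ (t x : Matrix n n k) (d : n → k) (a b : n),
      (Q : Matrix n n k) * t * ((Q⁻¹ : GL n k) : Matrix n n k) = Matrix.diagonal d →
      ((Q : Matrix n n k) * adLie t x * ((Q⁻¹ : GL n k) : Matrix n n k)) a b =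
        (d a - d b) * ((Q : Matrix n n k) * x * ((Q⁻¹ : GL n k) : Matrix n n k)) a b := by
    intro t x d a b ht
    rw [adLie_apply, mul_sub, sub_mul, conj_mul_conj, conj_mul_conj, ht, Matrix.sub_apply,
      Matrix.diagonal_mul, Matrix.mul_diagonal]
    ring
  have hpow : ∀ (N : ℕ) (a b : n),
      ((Q : Matrix n n k) * ((adLie s - (i : k) • 1) ^ N) y * ((Q⁻¹ : GL n k) : Matrix n n k)) a b =
        (σ a - σ b - i) ^ N *
          ((Q : Matrix n n k) * y * ((Q⁻¹ : GL n k) : Matrix n n k)) a b := by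
    intro N a b
    induction N with
    | zero => simp
    | succ N ih =>
      rw [pow_succ', Module.End.mul_apply, LinearMap.sub_apply, mul_sub, sub_mul, Matrix.sub_apply,
        hentry _ _ _ _ _ hQs, LinearMap.smul_apply, Module.End.one_apply, mul_smul_comm,
        smul_mul_assoc, Matrix.smul_apply, smul_eq_mul, ih]
      ring
  refine eq_of_conj_eq (Q := Q) (Matrix.ext fun a b => ?_)
  rw [hentry _ _ _ _ _ hQτ, mul_smul_comm, smul_mul_assoc, Matrix.smul_apply, smul_eq_mul]
  have h3 := hpow N a b
  rw [hN, mul_zero, zero_mul, Matrix.zero_apply] at h3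
  -- Either the eigenvalue difference is exactly `i`, or the entry of `y` vanishes.
  rcases mul_eq_zero.1 h3.symm with h4 | h4
  · have h5 : σ a - σ b = (i : k) := sub_eq_zero.1 (eq_zero_of_pow_eq_zero h4)
    have h6 := congrArg r h5
    have h7 : r (i : k) = (i : ZMod p) := by
      rw [← nsmul_one, map_nsmul, hr, nsmul_one]
    rw [← map_sub, ← map_sub, h6, h7, map_natCast]
  · rw [h4, mul_zero, mul_zero]

theorem HasRationalPart.conj [Infinite k] (hT : IsTorus T) {a : Matrix n n k} {h : GL n k}
    (hh : h ∈ G) (H : HasRationalPart r G T a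
      ((h : Matrix n n k) * τ * ((h⁻¹ : GL n k) : Matrix n n k))) :
    HasRationalPart r G T (((h⁻¹ : GL n k) : Matrix n n k) * a * (h : Matrix n n k)) τ := by
  obtain ⟨P, hP⟩ := hT.diagonalizable
  obtain ⟨s, ν, ⟨rfl, hc, -, hν⟩, g, hg, hs⟩ := H
  obtain ⟨σ, h1, -⟩ := hs.exists_diagonal hP
  have hgs : ((g * h : GL n k) : Matrix n n k) *
      (((h⁻¹ : GL n k) : Matrix n n k) * s * (h : Matrix n n k)) *
        (((g * h)⁻¹ : GL n k) : Matrix n n k) =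
      (g : Matrix n n k) * s * ((g⁻¹ : GL n k) : Matrix n n k) := by
    simp only [mul_inv_rev, Units.val_mul, mul_assoc]
    rw [← mul_assoc (h : Matrix n n k) ((h⁻¹ : GL n k) : Matrix n n k), h.mul_inv, one_mul,
      ← mul_assoc (h : Matrix n n k) ((h⁻¹ : GL n k) : Matrix n n k), h.mul_inv, one_mul]
  have hconj : ∀ x y : Matrix n n k, ((h⁻¹ : GL n k) : Matrix n n k) * (x * y) * h =
      ((h⁻¹ : GL n k) : Matrix n n k) * x * h * (((h⁻¹ : GL n k) : Matrix n n k) * y * h) := by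
    intro x y
    have := conj_mul_conj h⁻¹ x y
    rwa [inv_inv] at this
  refine ⟨_, ((h⁻¹ : GL n k) : Matrix n n k) * ν * (h : Matrix n n k),
    ⟨by rw [mul_add, add_mul], ?_, ?_, ?_⟩, g * h, mul_mem hg hh, ?_⟩
  · rw [Commute, SemiconjBy, ← hconj, ← hconj, hc.eq]
  · refine isSemisimple_toLin'_of_conj_diagonal (Q := P * (g * h)) (σ := σ) ?_
    rw [← h1, ← hgs]
    simp only [mul_inv_rev, Units.val_mul, mul_assoc]
  · obtain ⟨m, hm⟩ := hν
    refine ⟨m, ?_⟩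
    rw [show ((h⁻¹ : GL n k) : Matrix n n k) * ν * (h : Matrix n n k) =
      ((h⁻¹ : GL n k) : Matrix n n k) * ν * ((h⁻¹ : (GL n k))⁻¹ : GL n k) by rw [inv_inv],
      Units.conj_pow, hm, mul_zero, zero_mul]
  · rw [hgs]
    simpa only [mul_inv_rev, Units.val_mul, mul_assoc] using hs

/-- Subtracting `τ` from `s` removes the rational part; what needs proof is that `s - τ` still
commutes with `ν`, so that the decomposition remains a Jordan decomposition. -/
theorem HasRationalPart.sub_hasIrrationalSemisimplePart [Infinite k] (hr : r 1 = 1)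
    (hT : IsTorus T) {a : Matrix n n k} (H : HasRationalPart r G T a τ) :
    HasIrrationalSemisimplePart r G T τ (a - τ) := by
  have H' := H
  obtain ⟨P, hP⟩ := hT.diagonalizable
  obtain ⟨s, ν, ⟨rfl, hc, -, hν⟩, g, hg, hs⟩ := H
  have hτν : Commute τ ν := by
    -- As `ν` commutes with `s + ν`, the eigenvalue lemma with `i = 0` gives `[τ, ν] = 0`.
    have h1 : ν ∈ Module.End.maxGenEigenspace (adLie (s + ν)) ((0 : ℕ) : k) := by
      rw [Module.End.mem_maxGenEigenspace]
      refine ⟨1, ?_⟩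
      simp [adLie_apply, add_mul, mul_add, hc.eq]
    have h2 := H'.adLie_eq_smul hr hT h1
    rw [adLie_apply, Nat.cast_zero, zero_smul, sub_eq_zero] at h2
    exact h2
  have hs0 := hs.sub_self hr
  rw [← sub_mul, ← mul_sub] at hs0
  obtain ⟨σ, h1, -⟩ := hs0.exists_diagonal hP
  refine ⟨s - τ, ν, ⟨by abel, hc.sub_left hτν, ?_, hν⟩, g, hg, hs.mem_rationalPoints, hs0⟩
  refine isSemisimple_toLin'_of_conj_diagonal (Q := P * g) (σ := σ) ?_
  rw [← h1]
  simp only [mul_inv_rev, Units.val_mul, mul_assoc]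

/-- Both `s` and `τ` are diagonal in one basis, so they commute; with `[τ, a] = 0` this makes `τ`
commute with `ν` as well, and `s + τ` is the semisimple part of `a + τ`. -/
theorem HasIrrationalSemisimplePart.add_hasRationalPart [Infinite k] (hr : r 1 = 1)
    (hT : IsTorus T) {a : Matrix n n k} (H : HasIrrationalSemisimplePart r G T τ a)
    (ha : Commute τ a) : HasRationalPart r G T (a + τ) τ := by
  obtain ⟨P, hP⟩ := hT.diagonalizable
  obtain ⟨s, ν, ⟨rfl, hc, -, hν⟩, g, hg, hτ, hs⟩ := H
  obtain ⟨σ, h1, -⟩ := hs.exists_diagonal hP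
  obtain ⟨d, h2⟩ := exists_diagonal_of_mem_rationalPoints hP hτ
  have hQs : ((P * g : GL n k) : Matrix n n k) * s * (((P * g)⁻¹ : GL n k) : Matrix n n k) =
      Matrix.diagonal σ := by
    rw [← h1]; simp only [mul_inv_rev, Units.val_mul, mul_assoc]
  have hQτ : ((P * g : GL n k) : Matrix n n k) * τ * (((P * g)⁻¹ : GL n k) : Matrix n n k) =
      Matrix.diagonal fun i => (d i : k) := by
    rw [← h2]; simp only [mul_inv_rev, Units.val_mul, mul_assoc]
  have hτs : Commute τ s := commute_of_conj_diagonal hQτ hQs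
  have hτν : Commute τ ν := by
    have := ha.sub_right hτs
    rwa [add_sub_cancel_left] at this
  have hs' := hs.add (SplittingMapsTo.of_mem_rationalPoints hr hτ)
  rw [← add_mul, ← mul_add, zero_add] at hs'
  refine ⟨s + τ, ν, ⟨by abel, hc.add_left hτν, ?_, hν⟩, g, hg, hs'⟩
  refine isSemisimple_toLin'_of_conj_diagonal (Q := P * g)
    (σ := fun i => σ i + (d i : k)) ?_
  rw [mul_add, add_mul, hQs, hQτ, Matrix.diagonal_add]

theorem IsRationalSemisimple.mem_lieAlg [Infinite k] (hTG : T ≤ G)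
    (hτ : IsRationalSemisimple G T τ) : τ ∈ lieAlg G := by
  obtain ⟨g, hg, h⟩ := hτ
  have h1 := conj_mem_lieAlg (G.inv_mem hg) (lieAlg_mono hTG (rationalPoints_le_lieAlg h))
  rw [inv_inv] at h1
  simpa only [mul_assoc, g.inv_mul, mul_one, ← mul_assoc ((g⁻¹ : GL n k) : Matrix n n k) (g : Matrix n n k), one_mul] using h1

theorem IsRationalSemisimple.exists_diagonal [Infinite k] (hT : IsTorus T)
    (hτ : IsRationalSemisimple G T τ) : ∃ (Q : GL n k) (d : n → ℤ),
      (Q : Matrix n n k) * τ * ((Q⁻¹ : GL n k) : Matrix n n k) =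
        Matrix.diagonal fun i => (d i : k) := by
  obtain ⟨P, hP⟩ := hT.diagonalizable
  obtain ⟨g, -, h⟩ := hτ
  obtain ⟨d, hd⟩ := exists_diagonal_of_mem_rationalPoints hP h
  refine ⟨P * g, d, ?_⟩
  rw [← hd]
  simp only [mul_inv_rev, Units.val_mul, mul_assoc]

theorem coeffMat_zero_gaugeAct_const (h : GL n k) (A : Matrix n n k⟦X⟧) :
    coeffMat 0 (gaugeAct (Matrix.GeneralLinearGroup.map (algebraMap k k⟦X⟧) h) A) =
      (h : Matrix n n k) * coeffMat 0 A * ((h⁻¹ : GL n k) : Matrix n n k) := by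
  have h1 : ∀ h : GL n k, ((Matrix.GeneralLinearGroup.map (algebraMap k k⟦X⟧) h : GL n k⟦X⟧) :
    Matrix n n k⟦X⟧) = constMat (h : Matrix n n k) := fun _ => rfl
  rw [gaugeAct, adj, ← map_inv, h1, h1, coeffMat_add, coeffMat_mul_constMat, coeffMat_eulerMat,
    Nat.cast_zero, zero_smul, zero_mul, zero_add, coeffMat_mul_constMat, coeffMat_constMat_mul]

/-- A constant gauge transformation first makes the rational part equal to `τ`; the passage to
standard form then leaves the residue unchanged. -/
theorem Locsys.exists_isNormalized [PerfectField k] [Infinite k] (hT : IsTorus T)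
    (A : Locsys r G T τ) : ∃ B : Locsys r G T τ, A ≈ B ∧ B.IsNormalized := by
  obtain ⟨h, hh, H⟩ := A.rational
  have hg1 := const_mem_points (R := k⟦X⟧) (G.inv_mem hh)
  obtain ⟨g2, hg2, h0, hstd⟩ := exists_standardForm (gaugeAct_mem_loopAlg hg1 A.mem)
  have hrat : HasRationalPart r G T (coeffMat 0 (gaugeAct g2 (gaugeAct
      (Matrix.GeneralLinearGroup.map (algebraMap k k⟦X⟧) h⁻¹) A.form))) τ := by
    rw [h0, coeffMat_zero_gaugeAct_const, inv_inv]
    exact H.conj hT hh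
  refine ⟨⟨_, gaugeAct_mem_loopAlg hg2 (gaugeAct_mem_loopAlg hg1 A.mem), 1, one_mem _, ?_⟩,
    ⟨_, mul_mem hg2 hg1, gaugeAct_mul _ _ _⟩, hstd, hrat⟩
  simpa using hrat

variable [CharP k p]

/-- The condition `[τ, φ_i] = i φ_i` is horizontality under `rationalConn τ`, read off in degree
`i`. -/
theorem Higgs.rationalConn_eq_zero (φ : Higgs r G T τ) : rationalConn τ φ.form = 0 := by
  refine coeffMat_ext fun i => ?_
  have h := (φ.mem i).2
  rw [rationalConn_apply, coeffMat_sub, coeffMat_add, coeffMat_eulerMat, coeffMat_mul_constMat,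
    coeffMat_constMat_mul, ← h, adLie_apply]
  ext
  simp [coeffMat]

/-- The connection `φ + τ` defined by a Higgs field `φ`. -/
noncomputable def Higgs.toLocsys [Infinite k] (hr : r 1 = 1) (hT : IsMaximalTorus G T)
    (hτ : IsRationalSemisimple G T τ) (φ : Higgs r G T τ) : Locsys r G T τ where
  form := φ.form + constMat τ
  mem := fun i => by
    rw [coeffMat_add]
    exact add_mem (φ.mem i).1 (constMat_mem_loopAlg (hτ.mem_lieAlg hT.le) i)
  rational := by
    refine ⟨1, one_mem _, ?_⟩
    have h := (φ.mem 0).2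
    rw [adLie_apply, Nat.cast_zero, zero_smul, sub_eq_zero] at h
    rw [coeffMat_add, coeffMat_constMat, if_pos rfl]
    simpa using φ.irrational.add_hasRationalPart hr hT.torus h

/-- The Higgs field `A - τ` defined by a normalized connection `A`. -/
noncomputable def Locsys.toHiggs [Infinite k] (hr : r 1 = 1) (hT : IsMaximalTorus G T)
    (hτ : IsRationalSemisimple G T τ) (A : Locsys r G T τ) (hA : A.IsNormalized) :
    Higgs r G T τ where
  form := A.form - constMat τ
  mem := fun i => by
    have h1 := hA.2.adLie_eq_smul hr hT.torus (hA.1 i)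
    rw [coeffMat_sub]
    refine ⟨sub_mem (A.mem i) (constMat_mem_loopAlg (hτ.mem_lieAlg hT.le) i), ?_⟩
    rw [map_sub, h1, coeffMat_constMat]
    split_ifs with hi
    · subst hi
      simp [adLie_apply]
    · simp
  irrational := by
    rw [coeffMat_sub, coeffMat_constMat, if_pos rfl]
    exact hA.2.sub_hasIrrationalSemisimplePart hr hT.torus

theorem Locsys.toLocsys_toHiggs [Infinite k] (hr : r 1 = 1) (hT : IsMaximalTorus G T)
    (hτ : IsRationalSemisimple G T τ) (A : Locsys r G T τ) (hA : A.IsNormalized) :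
    (A.toHiggs hr hT hτ hA).toLocsys hr hT hτ = A := by
  obtain ⟨form, mem, rational⟩ := A
  simp only [Locsys.toHiggs, Higgs.toLocsys, sub_add_cancel]

/-- Assigning the inhomogeneous term to the summand `τ` lets an element fixing `d + τ dz/z` act on
the other summand by the adjoint action. -/
theorem gaugeAct_add (g : GL n k⟦X⟧) (A B : Matrix n n k⟦X⟧) :
    gaugeAct g (A + B) = adj g A + gaugeAct g B := by
  simp only [gaugeAct, adj, mul_add, add_mul]; abel

/-- Gauge transformations between the connections of two Higgs fields preserve `d + τ dz/z`. -/
theorem Higgs.mem_gaugeStabilizer_and_adj_eq [IsAlgClosed k] (hr : r 1 = 1)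
    (hT : IsMaximalTorus G T) (hτ : IsRationalSemisimple G T τ) (φ ψ : Higgs r G T τ)
    {g : GL n k⟦X⟧} (hg : g ∈ points k⟦X⟧ G)
    (h : gaugeAct g (φ.form + constMat τ) = ψ.form + constMat τ) :
    g ∈ gaugeStabilizer G τ ∧ adj g φ.form = ψ.form := by
  have : Infinite k := IsAlgClosed.instInfinite
  have h1 := gaugeAct_mul_self g (φ.form + constMat τ)
  rw [h, add_mul, mul_add] at h1
  have h2 : rationalConn τ (g : Matrix n n k⟦X⟧) = ψ.form * g - g * φ.form := by
    rw [rationalConn_apply, sub_eq_sub_iff_add_eq_add, h1]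
    abel
  have h3 := _root_.rationalConn_eq_zero hr (hτ.exists_diagonal hT.torus)
    (fun μ hμ => φ.irrational.eq_zero_of_mem_spectrum hT.torus hμ)
    (fun μ hμ => ψ.irrational.eq_zero_of_mem_spectrum hT.torus hμ)
    φ.rationalConn_eq_zero ψ.rationalConn_eq_zero h2
  rw [h3] at h2
  have h4 : adj g φ.form = ψ.form := by
    rw [adj, ← sub_eq_zero.1 h2.symm, mul_assoc, g.mul_inv, mul_one]
  refine ⟨⟨hg, ?_⟩, h4⟩
  rw [gaugeAct_add, h4] at h
  exact add_left_cancel h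

/-- The functor `φ ↦ φ + τ`, `g ↦ g`. -/
noncomputable def higgsToLocsys [Infinite k] (hr : r 1 = 1) (hT : IsMaximalTorus G T)
    (hτ : IsRationalSemisimple G T τ) : Higgs r G T τ ⥤ Locsys r G T τ where
  obj φ := φ.toLocsys hr hT hτ
  map {φ ψ} f := Locsys.Hom.mk (Higgs.Hom.val f) (Higgs.Hom.mem f).1 (by
    change gaugeAct _ (φ.form + constMat τ) = ψ.form + constMat τ
    rw [gaugeAct_add, Higgs.Hom.adj_eq f, (Higgs.Hom.mem f).2])
  map_id _ := rfl
  map_comp _ _ := rfl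

/-- Gauge equivalent connections are isomorphic. -/
theorem Locsys.nonempty_iso {A B : Locsys r G T τ} (h : A ≈ B) : Nonempty (A ≅ B) := by
  obtain ⟨g, hg, hgA⟩ := h
  exact ⟨{ hom := Locsys.Hom.mk g hg hgA
           inv := Locsys.Hom.mk g⁻¹ (inv_mem hg)
            (by rw [← hgA, ← gaugeAct_mul, inv_mul_cancel, gaugeAct_one])
           hom_inv_id := Locsys.Hom.ext (inv_mul_cancel g)
           inv_hom_id := Locsys.Hom.ext (mul_inv_cancel g) }⟩

theorem higgsToLocsys_isEquivalence [IsAlgClosed k] [Infinite k] (hr : r 1 = 1)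
    (hT : IsMaximalTorus G T) (hτ : IsRationalSemisimple G T τ) :
    (higgsToLocsys hr hT hτ).IsEquivalence where
  faithful := ⟨fun h => Higgs.Hom.ext (congrArg Locsys.Hom.val h)⟩
  full := ⟨fun {φ ψ} f => by
    obtain ⟨h1, h2⟩ := Higgs.mem_gaugeStabilizer_and_adj_eq hr hT hτ φ ψ (Locsys.Hom.mem f)
      (Locsys.Hom.gauge_eq f)
    exact ⟨Higgs.Hom.mk (Locsys.Hom.val f) h1 h2, rfl⟩⟩
  essSurj := ⟨fun A => by
    obtain ⟨B, hAB, hB⟩ := A.exists_isNormalized hT.torus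
    refine ⟨B.toHiggs hr hT hτ hB, ?_⟩
    change Nonempty ((B.toHiggs hr hT hτ hB).toLocsys hr hT hτ ≅ A)
    rw [Locsys.toLocsys_toHiggs]
    exact Locsys.nonempty_iso (Setoid.symm hAB)⟩

end Equivalence

theorem mainTheorem7 {k : Type*} [Field k] [IsAlgClosed k] {p : ℕ} [Fact p.Prime]
    [Algebra (ZMod p) k] [CharP k p] {n : Type*} [Fintype n] [DecidableEq n]
    (r : k →ₗ[ZMod p] ZMod p) (hr : r 1 = 1)
    (G T : Subgroup (GL n k)) (hG : IsConnectedReductive G) (hT : IsMaximalTorus G T)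
    (τ : Matrix n n k) (hτ : IsRationalSemisimple G T τ) :
    -- every connection can be put in standard form with rational part of the residue equal to `τ`
    (∀ A : Locsys r G T τ, ∃ B : Locsys r G T τ, A ≈ B ∧ B.IsNormalized) ∧
    -- `A ↦ A - τ` on such standard forms is a well-defined bijection on equivalence classes
    (∃ Φ : Quotient (Locsys.setoid r G T τ) ≃ Quotient (Higgs.setoid r G T τ),
      ∀ A : Locsys r G T τ, A.IsNormalized →
        ∃ φ : Higgs r G T τ, φ.form = A.form - constMat τ ∧ Φ ⟦A⟧ = ⟦φ⟧) ∧
    -- and the inverse `φ ↦ φ + τ`, with `g ↦ g` on morphisms, is an equivalence of categories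
    (∃ F : Higgs r G T τ ⥤ Locsys r G T τ,
      (∀ φ, (F.obj φ).form = φ.form + constMat τ) ∧
      (∀ (φ ψ : Higgs r G T τ) (f : φ ⟶ ψ), Locsys.Hom.val (F.map f) = Higgs.Hom.val f) ∧
      F.IsEquivalence) := by
  have : Infinite k := IsAlgClosed.instInfinite
  refine ⟨fun A => A.exists_isNormalized hT.torus, ?_,
    higgsToLocsys hr hT hτ, fun _ => rfl, fun _ _ _ => rfl, higgsToLocsys_isEquivalence hr hT hτ⟩
  -- The bijection is built as the inverse of `φ ↦ φ + τ`, which is defined on every Higgs field,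
  -- whereas `A ↦ A - τ` makes sense only for normalized `A`.
  let Ψ : Quotient (Higgs.setoid r G T τ) → Quotient (Locsys.setoid r G T τ) :=
    Quotient.map (Higgs.toLocsys hr hT hτ) (by
      rintro φ ψ ⟨g, hg, h⟩
      refine ⟨g, hg.1, ?_⟩
      change gaugeAct g (φ.form + constMat τ) = ψ.form + constMat τ
      rw [gaugeAct_add, h, hg.2])
  have hΨ : Function.Bijective Ψ := by
    constructor
    -- Injectivity is fullness: a gauge transformation between the two connections is already an
    -- equivalence of Higgs fields.
    · rintro ⟨φ⟩ ⟨ψ⟩ h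
      obtain ⟨g, hg, h'⟩ := Quotient.exact h
      have h1 := Higgs.mem_gaugeStabilizer_and_adj_eq hr hT hτ φ ψ hg h'
      exact Quotient.sound ⟨g, h1⟩
    · rintro ⟨A⟩
      obtain ⟨B, hAB, hB⟩ := A.exists_isNormalized hT.torus
      refine ⟨⟦B.toHiggs hr hT hτ hB⟧, ?_⟩
      refine (congrArg Quotient.mk'' (B.toLocsys_toHiggs hr hT hτ hB)).trans ?_
      exact Quotient.sound (Setoid.symm hAB)
  refine ⟨(Equiv.ofBijective Ψ hΨ).symm, fun A hA => ⟨A.toHiggs hr hT hτ hA, rfl, ?_⟩⟩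
  rw [Equiv.symm_apply_eq]
  exact (congrArg (Quotient.mk _) (A.toLocsys_toHiggs hr hT hτ hA)).symm
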